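/- Let $X$ be a set, $m\colon X\to(0,\infty)$, and for $1\le p<\infty$ let $\ell^p=\ell^p(X,m)$ be the Banach space of all $f\colon X\to\mathbb C$ with $\|f\|_p^p=\sum_{x}m(x)|f(x)|^p<\infty$; on $\ell^2$ put $\langle f,g\rangle=\sum_x m(x)f(x)\overline{g(x)}$. Let $(b,o,c)$ be a magnetic Schrödinger graph over $(X,m)$: $b\colon X\times X\to[0,\infty)$ is symmetric with $b(x,x)=0$ and $\sum_y b(x,y)<\infty$ for all $x$; $o\colon X\times X\to\{z\in\mathbb C:|z|=1\}$ satisfies $o(x,y)=\overline{o(y,x)}$; and $c\colon X\to\mathbb R$. For finitely supported $\varphi,\psi\colon X\to\mathbb C$ let $$Q(\varphi,\psi)=\tfrac12\sum_{x,y\in X}b(x,y)\bigl(\varphi(x)-o(x,y)\varphi(y)\bigr)\overline{\bigl(\psi(x)-o(x,y)\psi(y)\bigr)}+\sum_{x\in X}c(x)\varphi(x)\overline{\psi(x)}.$$ Assume that $Q$ is positive, i.e. $Q(\varphi,\varphi)\ge0$ for all finitely supported $\varphi$, and closable in $\ell^2$. Let $H_2$ be the positive self-adjoint operator on $\ell^2$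 associated with the closure of $Q$, and let $S_2(t)=e^{-tH_2}$, $t\ge0$. **Theorem.** Let $1\le p<\infty$. Assume that $S_2$ extends consistently to a strongly continuous semigroup $S_p$ on $\ell^p$, i.e. $S_p$ is a strongly continuous semigroup of bounded operators on $\ell^p$ with $S_2(t)f=S_p(t)f$ for all $f\in\ell^2\cap\ell^p$ and $t\ge0$, and let $-H_p$ be the generator of $S_p$. If $\inf_{x\in X}m(x)>0$, then $$\sigma(H_2)\subseteq\sigma(H_p).$$ -/

import Mathlib

open MeasureTheory Filter Topology
open scoped ENNReal NNReal ComplexConjugate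

/-! ## Weighted sequence spaces -/

/-- The measure `A ↦ ∑_{x ∈ A} m x` on all subsets of a set `X` with weights `m : X → (0, ∞)`. -/
noncomputable def weightMeasure {X : Type*} (m : X → Set.Ioi (0 : ℝ)) : @Measure X ⊤ :=
  @Measure.sum X X ⊤ fun x => ENNReal.ofReal (m x : ℝ) • @Measure.dirac X ⊤ x

/-- The complex Banach space `ℓ^p(X, m)`. -/
abbrev WeightedLp {X : Type*} (m : X → Set.Ioi (0 : ℝ)) (p : ℝ≥0∞) : Type _ :=
  @Lp X ℂ ⊤ _ p (weightMeasure m)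

theorem weightMeasure_singleton {X : Type*} (m : X → Set.Ioi (0 : ℝ)) (x : X) :
    weightMeasure m {x} = ENNReal.ofReal (m x : ℝ) := by
  let _ : MeasurableSpace X := ⊤
  have h : weightMeasure m {x} = ∑' y, ENNReal.ofReal (m y : ℝ) * Measure.dirac y {x} := by
    unfold weightMeasure
    rw [Measure.sum_apply _ MeasurableSpace.measurableSet_top]
    rfl
  rw [h, tsum_eq_single x]
  · simp
  · intro y hy
    simp [hy]

/-- Every point has positive mass, so "almost everywhere" means "everywhere". -/
theorem weightMeasure_ae {X : Type*} (m : X → Set.Ioi (0 : ℝ)) {P : X → Prop}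
    (h : ∀ᵐ x ∂(weightMeasure m), P x) (x : X) : P x := by
  by_contra hx
  have h1 : weightMeasure m {x} = 0 :=
    measure_mono_null (Set.singleton_subset_iff.2 hx) h
  rw [weightMeasure_singleton, ENNReal.ofReal_eq_zero] at h1
  exact absurd (m x).2 (not_lt.2 h1)

/-- An element of `ℓ^p(X, m)` as a function on `X`. -/
noncomputable def WeightedLp.eval {X : Type*} (m : X → Set.Ioi (0 : ℝ)) (p : ℝ≥0∞) :
    WeightedLp m p →ₗ[ℂ] (X → ℂ) where
  toFun f := f
  map_add' f g := funext (weightMeasure_ae m (Lp.coeFn_add f g))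
  map_smul' c f := funext (weightMeasure_ae m (Lp.coeFn_smul c f))

/-! ## Unbounded operators and strongly continuous semigroups -/

section Operators

variable {E : Type*} [NormedAddCommGroup E] [NormedSpace ℂ E]

/-- `R` is the bounded, everywhere defined two-sided inverse of `A - z`. -/
def LinearPMap.IsResolvent (A : E →ₗ.[ℂ] E) (z : ℂ) (R : E →L[ℂ] E) : Prop :=
  (∀ f : E, ∃ h : R f ∈ A.domain, A ⟨R f, h⟩ - z • R f = f) ∧
    ∀ u : A.domain, R (A u - z • (u : E)) = u

/-- The spectrum of an unbounded operator: the complement of the resolvent set. -/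
def LinearPMap.spec (A : E →ₗ.[ℂ] E) : Set ℂ :=
  {z | ∃ R : E →L[ℂ] E, A.IsResolvent z R}ᶜ

open Classical in
/-- The resolvent `(A - z)⁻¹` for `z` in the resolvent set. -/
noncomputable def LinearPMap.res (A : E →ₗ.[ℂ] E) (z : ℂ) : E →L[ℂ] E :=
  if h : ∃ R : E →L[ℂ] E, A.IsResolvent z R then h.choose else 0

/-- Strongly continuous one-parameter semigroups of bounded operators. -/
structure IsC0Semigroup (T : ℝ≥0 → E →L[ℂ] E) : Prop where
  map_zero : T 0 = ContinuousLinearMap.id ℂ E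
  map_add : ∀ s t, T (s + t) = (T s).comp (T t)
  continuous_orbit : ∀ f, Continuous fun t => T t f

/-- The (infinitesimal) generator `f ↦ lim_{t ↓ 0} (T t f - f) / t`, defined on all `f` for which
this limit exists. -/
noncomputable def semigroupGenerator (T : ℝ≥0 → E →L[ℂ] E) : E →ₗ.[ℂ] E where
  domain :=
    { carrier := {f | ∃ g, Tendsto (fun t : ℝ≥0 => ((t : ℝ) : ℂ)⁻¹ • (T t f - f)) (𝓝[>] 0) (𝓝 g)}
      add_mem' := by
        rintro f₁ f₂ ⟨g₁, h₁⟩ ⟨g₂, h₂⟩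
        refine ⟨g₁ + g₂, (h₁.add h₂).congr fun t => ?_⟩
        rw [_root_.map_add, ← smul_add]
        congr 1
        abel
      zero_mem' := ⟨0, by simp⟩
      smul_mem' := by
        rintro c f ⟨g, h⟩
        refine ⟨c • g, (h.const_smul c).congr fun t => ?_⟩
        rw [map_smul, ← smul_sub, smul_comm] }
  toFun :=
    { toFun := fun f => f.2.choose
      map_add' := by
        intro f₁ f₂
        refine tendsto_nhds_unique (f₁ + f₂).2.choose_spec
          ((f₁.2.choose_spec.add f₂.2.choose_spec).congr fun t => ?_)
        rw [Submodule.coe_add, _root_.map_add, ← smul_add]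
        congr 1
        abel
      map_smul' := by
        intro c f
        refine tendsto_nhds_unique (c • f).2.choose_spec
          ((f.2.choose_spec.const_smul c).congr fun t => ?_)
        rw [Submodule.coe_smul, map_smul, ← smul_sub, smul_comm] }

end Operators

/-! ## Positive forms, their closure, and the associated operator -/

/-- A positive Hermitian sesquilinear form (linear in the first argument, as in the convention
`⟨f, g⟩ = ∑ m f ḡ`) defined on a subspace of `E`. -/
structure PositiveForm (E : Type*) [NormedAddCommGroup E] [InnerProductSpace ℂ E] where
  dom : Submodule ℂ E
  form : dom →ₗ[ℂ] dom →ₗ⋆[ℂ] ℂ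
  symm : ∀ u v, conj (form u v) = form v u
  nonneg : ∀ u, 0 ≤ (form u u).re

namespace PositiveForm

variable {E : Type*} [NormedAddCommGroup E] [InnerProductSpace ℂ E] (q : PositiveForm E)

/-- The sequence `u` is Cauchy with respect to the form. -/
def IsFormCauchy (u : ℕ → q.dom) : Prop :=
  Tendsto (fun k : ℕ × ℕ => q.form (u k.1 - u k.2) (u k.1 - u k.2)) atTop (𝓝 0)

/-- The sequence `u` in the domain of the form is Cauchy with respect to the form and converges
to `f` in the Hilbert space. -/
def IsApprox (u : ℕ → q.dom) (f : E) : Prop :=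
  Tendsto (fun n => (u n : E)) atTop (𝓝 f) ∧ q.IsFormCauchy u

/-- Closability: form Cauchy sequences that tend to `0` in the Hilbert space tend to `0` with
respect to the form. -/
def IsClosable : Prop :=
  ∀ u : ℕ → q.dom, q.IsApprox u 0 → Tendsto (fun n => q.form (u n) (u n)) atTop (𝓝 0)

/-- The form as a semi-inner product. -/
@[reducible] def core : PreInnerProductSpace.Core ℂ q.dom where
  inner u v := q.form v u
  conj_inner_symm u v := q.symm u v
  re_inner_nonneg u := q.nonneg u
  add_left u v w := (q.form w).map_add u v
  smul_left u v r := (q.form v).map_smulₛₗ r u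

/-- The domain of the form with the seminorm of the form. -/
def Space : Type _ := q.dom

noncomputable instance : SeminormedAddCommGroup q.Space :=
  @InnerProductSpace.Core.toSeminormedAddCommGroup ℂ q.dom _ _ _ q.core

noncomputable instance : InnerProductSpace ℂ q.Space :=
  @InnerProductSpace.ofCore ℂ q.dom _ _ _ q.core

theorem inner_space (u v : q.Space) : inner ℂ u v = q.form v u := rfl

theorem norm_sq_space (u : q.Space) : (‖u‖ : ℂ) ^ 2 = q.form u u :=
  (inner_self_eq_norm_sq_to_K (𝕜 := ℂ) u).symm

theorem norm_form_self (u : q.Space) : ‖q.form u u‖ = ‖u‖ ^ 2 := by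
  rw [← norm_sq_space]
  simp

theorem tendsto_form_self_iff {ι : Type*} {l : Filter ι} (w : ι → q.Space) :
    Tendsto (fun i => q.form (w i) (w i)) l (𝓝 0) ↔ Tendsto (fun i => ‖w i‖) l (𝓝 0) := by
  rw [tendsto_zero_iff_norm_tendsto_zero]
  simp only [norm_form_self]
  constructor
  · intro h
    simpa using h.sqrt
  · intro h
    simpa using h.pow 2

/-- The Hilbert space completion of the domain with respect to the form. -/
noncomputable def toCompl (u : q.dom) : UniformSpace.Completion q.Space := 
  UniformSpace.Completion.coe' (α := q.Space) u

theorem toCompl_add (u v : q.dom) : q.toCompl (u + v) = q.toCompl u + q.toCompl v :=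
  UniformSpace.Completion.coe_add (α := q.Space) u v

theorem toCompl_sub (u v : q.dom) : q.toCompl (u - v) = q.toCompl u - q.toCompl v :=
  UniformSpace.Completion.coe_sub (α := q.Space) u v

theorem toCompl_smul (c : ℂ) (u : q.dom) : q.toCompl (c • u) = c • q.toCompl u :=
  UniformSpace.Completion.coe_smul (X := q.Space) c u

theorem toCompl_inner (u v : q.dom) : inner ℂ (q.toCompl u) (q.toCompl v) = q.form v u :=
  UniformSpace.Completion.inner_coe (E := q.Space) u v

theorem tendsto_toCompl_iff {ι : Type*} {l : Filter ι} (w : ι → q.dom) :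
    Tendsto (fun i => q.form (w i) (w i)) l (𝓝 0) ↔
      Tendsto (fun i => q.toCompl (w i)) l (𝓝 0) := by
  rw [tendsto_zero_iff_norm_tendsto_zero (f := fun i => q.toCompl (w i))]
  refine (q.tendsto_form_self_iff w).trans (Iff.of_eq ?_)
  congr 1
  exact funext fun i => (UniformSpace.Completion.norm_coe (E := q.Space) (w i)).symm

theorem isFormCauchy_iff (u : ℕ → q.dom) :
    q.IsFormCauchy u ↔ ∃ U, Tendsto (fun n => q.toCompl (u n)) atTop (𝓝 U) := by
  unfold IsFormCauchy
  rw [q.tendsto_toCompl_iff]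
  have h : Tendsto (fun k : ℕ × ℕ => q.toCompl (u k.1 - u k.2)) atTop (𝓝 0) ↔
      CauchySeq fun n => q.toCompl (u n) := by
    simp only [toCompl_sub]
    rw [cauchySeq_iff_tendsto, uniformity_eq_comap_nhds_zero_swapped, tendsto_comap_iff]
    rfl
  rw [h]
  exact ⟨cauchySeq_tendsto_of_complete, fun ⟨_, hU⟩ => hU.cauchySeq⟩

variable {q}

theorem IsApprox.add {u v : ℕ → q.dom} {f g : E} (hu : q.IsApprox u f) (hv : q.IsApprox v g) :
    q.IsApprox (fun n => u n + v n) (f + g) := by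
  refine ⟨hu.1.add hv.1, ?_⟩
  obtain ⟨U, hU⟩ := (q.isFormCauchy_iff u).1 hu.2
  obtain ⟨V, hV⟩ := (q.isFormCauchy_iff v).1 hv.2
  exact (q.isFormCauchy_iff _).2
    ⟨U + V, (hU.add hV).congr fun n => (q.toCompl_add _ _).symm⟩

theorem IsApprox.smul {u : ℕ → q.dom} {f : E} (c : ℂ) (hu : q.IsApprox u f) :
    q.IsApprox (fun n => c • u n) (c • f) := by
  refine ⟨hu.1.const_smul c, ?_⟩
  obtain ⟨U, hU⟩ := (q.isFormCauchy_iff u).1 hu.2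
  exact (q.isFormCauchy_iff _).2
    ⟨c • U, (hU.const_smul c).congr fun n => (q.toCompl_smul _ _).symm⟩

theorem isApprox_const (u : q.dom) : q.IsApprox (fun _ => u) u :=
  ⟨tendsto_const_nhds, (q.isFormCauchy_iff _).2 ⟨_, tendsto_const_nhds⟩⟩

theorem IsApprox.tendsto_unique (hcl : q.IsClosable) {u v : ℕ → q.dom} {f : E}
    (hu : q.IsApprox u f) (hv : q.IsApprox v f) {U V : UniformSpace.Completion q.Space}
    (hU : Tendsto (fun n => q.toCompl (u n)) atTop (𝓝 U))
    (hV : Tendsto (fun n => q.toCompl (v n)) atTop (𝓝 V)) : U = V := by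
  have h := hu.add (hv.smul (-1))
  rw [neg_one_smul, add_neg_cancel] at h
  have h1 := (q.tendsto_toCompl_iff _).1 (hcl _ h)
  have h2 : Tendsto (fun n => q.toCompl (u n + (-1 : ℂ) • v n)) atTop (𝓝 (U - V)) :=
    (hU.sub hV).congr fun n => by
      rw [toCompl_add, toCompl_smul, neg_one_smul, sub_eq_add_neg]
  exact sub_eq_zero.1 (tendsto_nhds_unique h2 h1)

variable (q)

/-- The domain of the closure of a form. -/
def closureDom : Submodule ℂ E where
  carrier := {f | ∃ u, q.IsApprox u f}
  add_mem' := fun ⟨_, hu⟩ ⟨_, hv⟩ => ⟨_, hu.add hv⟩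
  zero_mem' := ⟨_, isApprox_const 0⟩
  smul_mem' := fun c _ ⟨_, hu⟩ => ⟨_, hu.smul c⟩

theorem dom_le_closureDom : q.dom ≤ q.closureDom :=
  fun u hu => ⟨_, isApprox_const ⟨u, hu⟩⟩

/-- The value `lim q(uₙ, vₙ)` of the closure of a form, for approximating sequences `u` of `f` and
`v` of `g`. -/
noncomputable def closureForm (f g : q.closureDom) : ℂ :=
  limUnder atTop fun n => q.form (f.2.choose n) (g.2.choose n)

variable {q}

/-- The closure of a closable form does not depend on the approximating sequences. -/
theorem IsApprox.tendsto_closureForm (hcl : q.IsClosable) {f g : q.closureDom}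
    {u v : ℕ → q.dom} (hu : q.IsApprox u f) (hv : q.IsApprox v g) :
    Tendsto (fun n => q.form (u n) (v n)) atTop (𝓝 (q.closureForm f g)) := by
  have hf := f.2.choose_spec
  have hg := g.2.choose_spec
  obtain ⟨U, hU⟩ := (q.isFormCauchy_iff _).1 hu.2
  obtain ⟨V, hV⟩ := (q.isFormCauchy_iff _).1 hv.2
  obtain ⟨F, hF⟩ := (q.isFormCauchy_iff _).1 hf.2
  obtain ⟨G, hG⟩ := (q.isFormCauchy_iff _).1 hg.2
  obtain rfl := hu.tendsto_unique hcl hf hU hF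
  obtain rfl := hv.tendsto_unique hcl hg hV hG
  have h1 := hV.inner (𝕜 := ℂ) hU
  have h2 := hG.inner (𝕜 := ℂ) hF
  simp only [toCompl_inner] at h1 h2
  unfold closureForm
  rwa [h2.limUnder_eq]

variable (q)

/-- The closure of a closable positive form. -/
noncomputable def closure (hcl : q.IsClosable) : PositiveForm E where
  dom := q.closureDom
  form := LinearMap.mk₂'ₛₗ (RingHom.id ℂ) (starRingEnd ℂ) q.closureForm
    (by
      rintro ⟨f, u, hu⟩ ⟨g, v, hv⟩ ⟨h, w, hw⟩
      refine tendsto_nhds_unique (IsApprox.tendsto_closureForm hcl (hu.add hv) hw)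
        (((IsApprox.tendsto_closureForm hcl hu hw).add
          (IsApprox.tendsto_closureForm hcl hv hw)).congr fun n => ?_)
      simp)
    (by
      rintro c ⟨f, u, hu⟩ ⟨g, v, hv⟩
      refine tendsto_nhds_unique (IsApprox.tendsto_closureForm hcl (hu.smul c) hv)
        (((IsApprox.tendsto_closureForm hcl hu hv).const_smul c).congr fun n => ?_)
      simp)
    (by
      rintro ⟨h, w, hw⟩ ⟨f, u, hu⟩ ⟨g, v, hv⟩
      refine tendsto_nhds_unique (IsApprox.tendsto_closureForm hcl hw (hu.add hv))
        (((IsApprox.tendsto_closureForm hcl hw hu).add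
          (IsApprox.tendsto_closureForm hcl hw hv)).congr fun n => ?_)
      simp)
    (by
      rintro c ⟨f, u, hu⟩ ⟨g, v, hv⟩
      refine tendsto_nhds_unique (IsApprox.tendsto_closureForm hcl hu (hv.smul c))
        (((IsApprox.tendsto_closureForm hcl hu hv).const_smul (conj c)).congr fun n => ?_)
      simp)
  symm := by
    rintro ⟨f, u, hu⟩ ⟨g, v, hv⟩
    exact tendsto_nhds_unique
      (((Complex.continuous_conj.tendsto _).comp
        (IsApprox.tendsto_closureForm hcl hu hv)).congr fun n => q.symm _ _)
      (IsApprox.tendsto_closureForm hcl hv hu)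
  nonneg := by
    rintro ⟨f, u, hu⟩
    exact ge_of_tendsto' ((Complex.continuous_re.tendsto _).comp
      (IsApprox.tendsto_closureForm hcl hu hu)) fun n => q.nonneg (u n)

theorem dense_closure (hcl : q.IsClosable) (hd : Dense (q.dom : Set E)) :
    Dense ((q.closure hcl).dom : Set E) :=
  hd.mono q.dom_le_closureDom

/-- The domain of the operator associated with a form `q`: all `f ∈ D(q)` for which there is `g`
with `q(f, h) = ⟨g, h⟩` for all `h ∈ D(q)`. Here `⟨g, h⟩ = inner ℂ h g` is linear in `g`. -/
def operatorDomain : Submodule ℂ E where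
  carrier := {f | ∃ hf : f ∈ q.dom, ∃ g : E, ∀ h : q.dom, q.form ⟨f, hf⟩ h = inner ℂ (h : E) g}
  add_mem' := by
    rintro f₁ f₂ ⟨hf₁, g₁, h₁⟩ ⟨hf₂, g₂, h₂⟩
    refine ⟨q.dom.add_mem hf₁ hf₂, g₁ + g₂, fun h => ?_⟩
    rw [inner_add_right, ← h₁, ← h₂]
    exact LinearMap.map_add₂ q.form ⟨f₁, hf₁⟩ ⟨f₂, hf₂⟩ h
  zero_mem' := ⟨q.dom.zero_mem, 0, fun h => by
    rw [inner_zero_right]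
    exact LinearMap.map_zero₂ q.form h⟩
  smul_mem' := by
    rintro c f ⟨hf, g, hg⟩
    refine ⟨q.dom.smul_mem c hf, c • g, fun h => ?_⟩
    rw [inner_smul_right, ← hg]
    exact LinearMap.map_smul₂ q.form c ⟨f, hf⟩ h

/-- The vector `g` with `q(f, h) = ⟨g, h⟩` for all `h ∈ D(q)`. -/
noncomputable def operatorFun (f : q.operatorDomain) : E := f.2.choose_spec.choose

theorem operatorFun_spec (f : q.operatorDomain) (h : q.dom) :
    q.form ⟨f, f.2.choose⟩ h = inner ℂ (h : E) (q.operatorFun f) :=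
  f.2.choose_spec.choose_spec h

/-- The operator associated with a densely defined form. -/
noncomputable def operator (hd : Dense (q.dom : Set E)) : E →ₗ.[ℂ] E where
  domain := q.operatorDomain
  toFun :=
    { toFun := q.operatorFun
      map_add' := by
        intro f₁ f₂
        refine hd.eq_of_inner_right ℂ fun h hh => ?_
        have e₁ := q.operatorFun_spec f₁ ⟨h, hh⟩
        have e₂ := q.operatorFun_spec f₂ ⟨h, hh⟩
        have e := q.operatorFun_spec (f₁ + f₂) ⟨h, hh⟩
        rw [inner_add_right]
        refine e.symm.trans (Eq.trans ?_ (congrArg₂ (· + ·) e₁ e₂))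
        exact LinearMap.map_add₂ q.form ⟨f₁, f₁.2.choose⟩ ⟨f₂, f₂.2.choose⟩ ⟨h, hh⟩
      map_smul' := by
        intro c f
        refine hd.eq_of_inner_right ℂ fun h hh => ?_
        have e₁ := q.operatorFun_spec f ⟨h, hh⟩
        have e := q.operatorFun_spec (c • f) ⟨h, hh⟩
        rw [RingHom.id_apply, inner_smul_right]
        refine e.symm.trans (Eq.trans ?_ (congrArg (c * ·) e₁))
        exact LinearMap.map_smul₂ q.form c ⟨f, f.2.choose⟩ ⟨h, hh⟩ }

end PositiveForm

/-- The contraction semigroup `e^{-tA}` of a positive self-adjoint operator `A`, through the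
continuous functional calculus of the bounded self-adjoint operator `R = (A + 1)⁻¹`, whose spectrum
lies in `[0, 1]`: since `A = R⁻¹ - 1`, one has `e^{-tA} = φ(R)` with `φ(x) = e^{-t(1/x - 1)}` for
`x > 0` and `φ(0) = 0`, a continuous function on `[0, 1]` when `t > 0`. -/
noncomputable def expNeg {E : Type*} [NormedAddCommGroup E] [InnerProductSpace ℂ E]
    [CompleteSpace E] (A : E →ₗ.[ℂ] E) (t : ℝ≥0) : E →L[ℂ] E :=
  if t = 0 then ContinuousLinearMap.id ℂ E
  else cfc (fun x : ℝ => if x = 0 then 0 else Real.exp (-(t : ℝ) * (x⁻¹ - 1))) (A.res (-1))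

/-! ## Magnetic Schrödinger graphs -/

/-- A magnetic Schrödinger graph `(b, o, c)` over `X`: a graph `b`, a magnetic potential `o` and an
electric potential `c`. -/
structure MagneticSchrodingerGraph (X : Type*) where
  b : X → X → ℝ
  b_nonneg : ∀ x y, 0 ≤ b x y
  b_symm : ∀ x y, b x y = b y x
  b_diag : ∀ x, b x x = 0
  b_summable : ∀ x, Summable (b x)
  o : X → X → Circle
  o_symm : ∀ x y, (o x y : ℂ) = conj (o y x : ℂ)
  c : X → ℝ

namespace MagneticSchrodingerGraph

variable {X : Type*} (G : MagneticSchrodingerGraph X)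

/-- The magnetic gradient `∇ₒ f (x, y) = f(x) - o(x, y) f(y)`. -/
def grad (f : X → ℂ) (z : X × X) : ℂ := f z.1 - G.o z.1 z.2 * f z.2

/-- `Q(φ, ψ) = 1/2 ∑_{X × X} b ∇ₒφ conj(∇ₒψ) + ∑_X c φ conj(ψ)`, for finitely supported `φ`, `ψ`. -/
noncomputable def Q (φ ψ : X → ℂ) : ℂ :=
  1 / 2 * ∑' z : X × X, G.b z.1 z.2 * G.grad φ z * conj (G.grad ψ z) +
    ∑' x, G.c x * φ x * conj (ψ x)

/-- `Q` is positive: `Q(φ, φ) ≥ 0` for all finitely supported `φ`. -/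
def IsPositive : Prop := ∀ φ : X → ℂ, φ.support.Finite → 0 ≤ (G.Q φ φ).re

theorem summable_indicator (S : Finset X) :
    Summable fun z : X × X => (S : Set X).indicator (fun _ => G.b z.1 z.2) z.1 := by
  classical
  rw [summable_prod_of_nonneg (fun z => Set.indicator_nonneg (fun _ _ => G.b_nonneg _ _) _)]
  constructor
  · intro x
    by_cases hx : x ∈ (S : Set X)
    · simpa [Set.indicator_of_mem hx] using G.b_summable x
    · simp [Set.indicator_of_notMem hx]
  · refine summable_of_ne_finset_zero (s := S) fun x hx => ?_
    have hx' : x ∉ (S : Set X) := hx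
    simp [Set.indicator_of_notMem hx']

theorem summable_grad {φ ψ : X → ℂ} (hφ : φ.support.Finite) (hψ : ψ.support.Finite) :
    Summable fun z : X × X => (G.b z.1 z.2 : ℂ) * G.grad φ z * conj (G.grad ψ z) := by
  have bdd : ∀ f : X → ℂ, f.support.Finite → ∃ C : ℝ, ∀ x, ‖f x‖ ≤ C := by
    intro f hf
    obtain ⟨C, hC⟩ := (hf.image fun x => ‖f x‖).bddAbove
    refine ⟨max C 0, fun x => ?_⟩
    by_cases hx : f x = 0
    · simp [hx]
    · exact le_max_of_le_left (hC ⟨x, hx, rfl⟩)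
  obtain ⟨C, hC⟩ := bdd φ hφ
  obtain ⟨D, hD⟩ := bdd ψ hψ
  have hgrad : ∀ (f : X → ℂ) (z : X × X), ‖G.grad f z‖ ≤ ‖f z.1‖ + ‖f z.2‖ := by
    intro f z
    refine (norm_sub_le _ _).trans (le_of_eq ?_)
    rw [norm_mul, Circle.norm_coe, one_mul]
  have h1 := G.summable_indicator hφ.toFinset
  have h2 := (Equiv.prodComm X X).summable_iff.2 h1
  refine Summable.of_norm_bounded ((h1.add h2).mul_left (2 * C * (2 * D))) fun z => ?_
  have hC0 : 0 ≤ C := (norm_nonneg _).trans (hC z.1)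
  have hD0 : 0 ≤ D := (norm_nonneg _).trans (hD z.1)
  have hb := G.b_nonneg z.1 z.2
  have i1 : 0 ≤ ((hφ.toFinset : Set X)).indicator (fun _ => G.b z.1 z.2) z.1 :=
    Set.indicator_nonneg (fun _ _ => hb) _
  have i2 : 0 ≤ ((hφ.toFinset : Set X)).indicator (fun _ => G.b z.2 z.1) z.2 :=
    Set.indicator_nonneg (fun _ _ => G.b_nonneg _ _) _
  simp only [Function.comp_apply, Equiv.prodComm_apply, Prod.fst_swap, Prod.snd_swap]
  by_cases hz : G.grad φ z = 0
  · rw [hz]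
    simp only [mul_zero, zero_mul, norm_zero]
    positivity
  have key : G.b z.1 z.2 ≤ ((hφ.toFinset : Set X)).indicator (fun _ => G.b z.1 z.2) z.1 +
      ((hφ.toFinset : Set X)).indicator (fun _ => G.b z.2 z.1) z.2 := by
    by_cases h : φ z.1 = 0
    · have h' : φ z.2 ≠ 0 := by
        intro h'
        exact hz (by simp [grad, h, h'])
      rw [Set.indicator_of_mem (a := z.2) (by simpa using h'), G.b_symm z.2 z.1]
      linarith
    · rw [Set.indicator_of_mem (a := z.1) (by simpa using h)]
      linarith
  have e1 : ‖G.grad φ z‖ ≤ 2 * C := (hgrad φ z).trans (by linarith [hC z.1, hC z.2])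
  have e2 : ‖G.grad ψ z‖ ≤ 2 * D := (hgrad ψ z).trans (by linarith [hD z.1, hD z.2])
  rw [norm_mul, norm_mul, RCLike.norm_conj, Complex.norm_real, Real.norm_of_nonneg hb]
  calc G.b z.1 z.2 * ‖G.grad φ z‖ * ‖G.grad ψ z‖
      ≤ G.b z.1 z.2 * (2 * C) * (2 * D) := by gcongr
    _ = 2 * C * (2 * D) * G.b z.1 z.2 := by ring
    _ ≤ _ := by gcongr

theorem summable_pot {φ : X → ℂ} (hφ : φ.support.Finite) (ψ : X → ℂ) :
    Summable fun x => (G.c x : ℂ) * φ x * conj (ψ x) :=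
  summable_of_hasFiniteSupport (hφ.subset fun x hx h => hx (by simp [h]))

theorem Q_symm (φ ψ : X → ℂ) : conj (G.Q φ ψ) = G.Q ψ φ := by
  unfold Q
  rw [_root_.map_add, _root_.map_mul, Complex.conj_tsum, Complex.conj_tsum]
  congr 1
  · congr 1
    · rw [map_div₀, map_one, Complex.conj_ofNat]
    · refine tsum_congr fun z => ?_
      simp only [_root_.map_mul, Complex.conj_ofReal, Complex.conj_conj]
      ring
  · refine tsum_congr fun x => ?_
    simp only [_root_.map_mul, Complex.conj_ofReal, Complex.conj_conj]
    ring

theorem Q_add {φ₁ φ₂ ψ : X → ℂ} (h₁ : φ₁.support.Finite) (h₂ : φ₂.support.Finite)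
    (hψ : ψ.support.Finite) : G.Q (φ₁ + φ₂) ψ = G.Q φ₁ ψ + G.Q φ₂ ψ := by
  have e1 : ∀ z : X × X, (G.b z.1 z.2 : ℂ) * G.grad (φ₁ + φ₂) z * conj (G.grad ψ z) =
      G.b z.1 z.2 * G.grad φ₁ z * conj (G.grad ψ z) +
        G.b z.1 z.2 * G.grad φ₂ z * conj (G.grad ψ z) := by
    intro z
    simp only [grad, Pi.add_apply]
    ring
  have e2 : ∀ x, (G.c x : ℂ) * (φ₁ + φ₂) x * conj (ψ x) =
      G.c x * φ₁ x * conj (ψ x) + G.c x * φ₂ x * conj (ψ x) := by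
    intro x
    simp only [Pi.add_apply]
    ring
  unfold Q
  rw [tsum_congr e1, tsum_congr e2, (G.summable_grad h₁ hψ).tsum_add (G.summable_grad h₂ hψ),
    (G.summable_pot h₁ ψ).tsum_add (G.summable_pot h₂ ψ)]
  ring

theorem Q_smul (a : ℂ) (φ ψ : X → ℂ) : G.Q (a • φ) ψ = a * G.Q φ ψ := by
  have e1 : ∀ z : X × X, (G.b z.1 z.2 : ℂ) * G.grad (a • φ) z * conj (G.grad ψ z) =
      a * (G.b z.1 z.2 * G.grad φ z * conj (G.grad ψ z)) := by
    intro z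
    simp only [grad, Pi.smul_apply, smul_eq_mul]
    ring
  have e2 : ∀ x, (G.c x : ℂ) * (a • φ) x * conj (ψ x) = a * (G.c x * φ x * conj (ψ x)) := by
    intro x
    simp only [Pi.smul_apply, smul_eq_mul]
    ring
  unfold Q
  rw [tsum_congr e1, tsum_congr e2, tsum_mul_left, tsum_mul_left]
  ring

/-- The finitely supported functions, as a subspace of `ℓ²(X, m)`. -/
def finSupp (m : X → Set.Ioi (0 : ℝ)) : Submodule ℂ (WeightedLp m 2) where
  carrier := {f | (WeightedLp.eval m 2 f).support.Finite}
  add_mem' := by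
    intro f g hf hg
    rw [Set.mem_ofPred_eq, _root_.map_add]
    exact (Set.Finite.union hf hg).subset (Function.support_add _ _)
  zero_mem' := by simp
  smul_mem' := by
    intro c f hf
    rw [Set.mem_ofPred_eq, map_smul]
    exact Set.Finite.subset hf (Function.support_const_smul_subset _ _)

theorem dense_finSupp (m : X → Set.Ioi (0 : ℝ)) :
    Dense (finSupp m : Set (WeightedLp m 2)) := by
  let _ : MeasurableSpace X := ⊤
  rw [Submodule.dense_iff_topologicalClosure_eq_top, Submodule.topologicalClosure_eq_top_iff,
    Submodule.eq_bot_iff]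
  intro g hg
  have hfin : ∀ x, weightMeasure m {x} ≠ ∞ := fun x => by
    rw [weightMeasure_singleton]
    exact ENNReal.ofReal_ne_top
  have hx : ∀ x, g x = 0 := by
    intro x
    have hs : MeasurableSet ({x} : Set X) := MeasurableSpace.measurableSet_top
    have hmem : indicatorConstLp 2 hs (hfin x) (1 : ℂ) ∈ finSupp m := by
      refine (Set.finite_singleton x).subset fun y hy => ?_
      by_contra hyx
      refine hy ?_
      have h := weightMeasure_ae m
        (indicatorConstLp_coeFn (p := 2) (hs := hs) (hμs := hfin x) (c := (1 : ℂ))) y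
      exact h.trans (Set.indicator_of_notMem hyx _)
    have h0 := (Submodule.mem_orthogonal _ _).1 hg _ hmem
    rw [L2.inner_indicatorConstLp_one, integral_singleton] at h0
    rw [smul_eq_zero] at h0
    refine h0.resolve_left ?_
    rw [measureReal_def, weightMeasure_singleton, ENNReal.toReal_ofReal (m x).2.le]
    exact (m x).2.ne'
  refine Lp.ext ?_
  filter_upwards [Lp.coeFn_zero ℂ 2 (weightMeasure m)] with x h
  rw [hx x, h]
  rfl

/-- The form `Q` on `C_c(X) ⊆ ℓ²(X, m)`. -/
noncomputable def form (m : X → Set.Ioi (0 : ℝ)) (hpos : G.IsPositive) :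
    PositiveForm (WeightedLp m 2) where
  dom := finSupp m
  form := LinearMap.mk₂'ₛₗ (RingHom.id ℂ) (starRingEnd ℂ)
    (fun φ ψ => G.Q (WeightedLp.eval m 2 φ) (WeightedLp.eval m 2 ψ))
    (fun φ₁ φ₂ ψ => by
      rw [Submodule.coe_add, _root_.map_add]
      exact G.Q_add φ₁.2 φ₂.2 ψ.2)
    (fun a φ ψ => by
      rw [Submodule.coe_smul, map_smul]
      exact G.Q_smul a _ _)
    (fun ψ φ₁ φ₂ => by
      rw [Submodule.coe_add, _root_.map_add, ← G.Q_symm, G.Q_add φ₁.2 φ₂.2 ψ.2, _root_.map_add,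
        G.Q_symm, G.Q_symm])
    (fun a ψ φ => by
      rw [Submodule.coe_smul, map_smul, ← G.Q_symm, G.Q_smul, _root_.map_mul, G.Q_symm]
      rfl)
  symm φ ψ := G.Q_symm _ _
  nonneg φ := hpos _ φ.2

/-- The magnetic Schrödinger operator `H₂` on `ℓ²(X, m)`: the positive self-adjoint operator
associated with the closure of `Q`. -/
noncomputable def H₂ (m : X → Set.Ioi (0 : ℝ)) (hpos : G.IsPositive)
    (hcl : (G.form m hpos).IsClosable) : WeightedLp m 2 →ₗ.[ℂ] WeightedLp m 2 :=
  ((G.form m hpos).closure hcl).operator ((G.form m hpos).dense_closure hcl (dense_finSupp m))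

/-- The magnetic Schrödinger semigroup `S₂(t) = e^{-t H₂}` on `ℓ²(X, m)`. -/
noncomputable def S₂ (m : X → Set.Ioi (0 : ℝ)) (hpos : G.IsPositive)
    (hcl : (G.form m hpos).IsClosable) (t : ℝ≥0) : WeightedLp m 2 →L[ℂ] WeightedLp m 2 :=
  expNeg (G.H₂ m hpos hcl) t

end MagneticSchrodingerGraph

/-- The family `T` on `ℓ^p(X, m)` is consistent with the family `S` on `ℓ²(X, m)`:
`S t = T t` on `ℓ² ∩ ℓ^p` for all `t ≥ 0`. -/
def IsConsistentExtension {X : Type*} {m : X → Set.Ioi (0 : ℝ)} {p : ℝ≥0∞} [Fact (1 ≤ p)]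
    (S : ℝ≥0 → WeightedLp m 2 →L[ℂ] WeightedLp m 2)
    (T : ℝ≥0 → WeightedLp m p →L[ℂ] WeightedLp m p) : Prop :=
  ∀ (t : ℝ≥0) (f : WeightedLp m 2) (g : WeightedLp m p),
    WeightedLp.eval m 2 f = WeightedLp.eval m p g →
      WeightedLp.eval m 2 (S t f) = WeightedLp.eval m p (T t g)

/-! ## Resolvents -/

section Resolvent

variable {E : Type*} [NormedAddCommGroup E] [NormedSpace ℂ E]

namespace LinearPMap

variable {A : E →ₗ.[ℂ] E} {z : ℂ}

/-! Write `A` for $H_2$ and $K=(A+1)^{-1}$, a bounded self-adjoint operator with spectrum in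
$[0,1]$. On the domain of `A` one has $A-z=(1-(1+z)K)(A+1)$, so $z$ is a resolvent point of `A` as
soon as $1-(1+z)K$ is invertible. For nonreal $z$ self-adjointness gives this.

Let $z$ be real with $R=(H_p-z)^{-1}$ bounded on $\ell^p$. Since $m$ is bounded below,
$\ell^p\subseteq\ell^q$ continuously for $p\le q<\infty$. If $p\le2$, consistency of the semigroups
passes to the generators, so $R$ inverts $A-z$ on the dense subspace $\ell^p$ of $\ell^2$ and is
symmetric for the $\ell^2$ inner product. A theorem of Krein and Lax
(`isUnit_one_sub_smul_of_dense`) says that such a map is automatically bounded in the Hilbert norm,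
and its extension inverts $A-z$. If $p\ge2$, the same theorem is applied to the transpose of $R$ on
$(\ell^p)^*$, which embeds densely in $\ell^2$ by Riesz representation. Neither duality of the
semigroups nor interpolation is needed.

Two identifications link the definitions to this argument: $K=JJ^*$, where $J$ projects the form
domain to the Hilbert space (`isResolvent_operator_closure`), and the generator of $e^{-tA}$ is $-A$
(`tendsto_expNeg_iff`). -/

theorem IsResolvent.eq {R R' : E →L[ℂ] E} (h : A.IsResolvent z R) (h' : A.IsResolvent z R') :
    R = R' := by
  ext f
  obtain ⟨hd, he⟩ := h'.1 f
  have h1 := h.2 ⟨R' f, hd⟩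
  rwa [he] at h1

theorem IsResolvent.res_eq {R : E →L[ℂ] E} (h : A.IsResolvent z R) : A.res z = R := by
  have hex : ∃ R : E →L[ℂ] E, A.IsResolvent z R := ⟨R, h⟩
  unfold res
  rw [dif_pos hex]
  exact hex.choose_spec.eq h

/-- The graph of `A` in terms of `K = (A + 1)⁻¹`. -/
theorem IsResolvent.apply_eq_iff {K : E →L[ℂ] E} (h : A.IsResolvent (-1) K) {u f : E} :
    (∃ hu : u ∈ A.domain, A ⟨u, hu⟩ = f) ↔ K (f + u) = u := by
  constructor
  · rintro ⟨hu, rfl⟩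
    simpa using h.2 ⟨u, hu⟩
  · intro hK
    obtain ⟨hd, he⟩ := h.1 (f + u)
    have key : ∀ v (hv : v ∈ A.domain), v = u → A ⟨v, hv⟩ = f + u - v →
        ∃ hu : u ∈ A.domain, A ⟨u, hu⟩ = f := by
      rintro v hv rfl h2
      exact ⟨hv, by rw [h2, add_sub_cancel_right]⟩
    refine key _ hd hK ?_
    rw [neg_one_smul, sub_neg_eq_add] at he
    exact eq_sub_of_add_eq he

theorem IsResolvent.injective {K : E →L[ℂ] E} (h : A.IsResolvent (-1) K) :
    Function.Injective K := by
  rw [injective_iff_map_eq_zero]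
  intro g hg
  obtain ⟨hd, he⟩ := h.1 g
  have key : ∀ v (hv : v ∈ A.domain), v = 0 → A ⟨v, hv⟩ = 0 := by
    rintro v hv rfl
    exact A.map_zero
  rw [key _ hd hg, hg, smul_zero, sub_zero] at he
  exact he.symm

/-- From $A-z=(1-(1+z)K)(A+1)$ on the domain, the inverse of $A-z$ is $PK$ with $P=(1-(1+z)K)^{-1}$,
which commutes with $K$. -/
theorem IsResolvent.notMem_spec {K : E →L[ℂ] E} (h : A.IsResolvent (-1) K)
    (hu : IsUnit (1 - (1 + z) • K)) : z ∉ A.spec := by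
  obtain ⟨L, hL⟩ := hu
  have hKL : Commute K (L : E →L[ℂ] E) := by
    rw [hL]
    exact (Commute.one_right K).sub_right ((Commute.refl K).smul_right _)
  have hL1 : ∀ v, (L : E →L[ℂ] E) v = v - (1 + z) • K v := fun v => by rw [hL]; simp
  set P : E →L[ℂ] E := (↑L⁻¹ : E →L[ℂ] E) with hP
  have hLP : ∀ v, (L : E →L[ℂ] E) (P v) = v := fun v =>
    congrArg (fun T : E →L[ℂ] E => T v) L.mul_inv
  have hPL : ∀ v, P ((L : E →L[ℂ] E) v) = v := fun v =>
    congrArg (fun T : E →L[ℂ] E => T v) L.inv_mul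
  have hPK : ∀ v, K (P v) = P (K v) := fun v =>
    congrArg (fun T : E →L[ℂ] E => T v) hKL.units_inv_right.eq
  refine fun hz => hz ⟨P * K, ?_, ?_⟩
  · intro f
    have h1 : K ((f + z • P (K f)) + P (K f)) = P (K f) := by
      have h2 := hLP (K f)
      rw [hL1, sub_eq_iff_eq_add] at h2
      have e : f + z • P (K f) + P (K f) = f + (1 + z) • P (K f) := by
        rw [add_smul, one_smul]
        abel
      rw [e, _root_.map_add, _root_.map_smul, ← h2]
    obtain ⟨hd, he⟩ := h.apply_eq_iff.2 h1
    refine ⟨hd, ?_⟩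
    change A ⟨P (K f), hd⟩ - z • P (K f) = f
    rw [he, add_sub_cancel_right]
  · rintro ⟨u, hu⟩
    have h1 := h.apply_eq_iff.1 ⟨hu, rfl⟩
    change P (K (A ⟨u, hu⟩ - z • u)) = u
    have h2 : K (A ⟨u, hu⟩ - z • u) = (L : E →L[ℂ] E) u := by
      rw [_root_.map_add] at h1
      rw [hL1, _root_.map_sub, _root_.map_smul, add_smul, one_smul, eq_sub_iff_add_eq.2 h1]
      abel
    rw [h2, hPL]

end LinearPMap

end Resolvent

/-! ## Resolvent points of positive self-adjoint operators -/

/-- A sequence of nonnegative numbers with `b (n + 1) ^ 2 ≤ b n * b (n + 2)` that grows at most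
like `C ^ n` satisfies `b 1 ≤ C * b 0`. -/
theorem le_mul_of_logConvex {b : ℕ → ℝ} {C M : ℝ} (hb : ∀ n, 0 ≤ b n) (hC : 0 ≤ C)
    (hconv : ∀ n, b (n + 1) ^ 2 ≤ b n * b (n + 2)) (hgrow : ∀ n, b n ≤ M * C ^ n) :
    b 1 ≤ C * b 0 := by
  rcases (hb 0).eq_or_lt with h0 | h0
  · have := hconv 0
    rw [← h0, zero_mul] at this
    rw [pow_eq_zero_iff two_ne_zero |>.1 (le_antisymm this (sq_nonneg _)), ← h0, mul_zero]
  -- Log-convexity makes the ratios of consecutive terms nondecreasing. A first ratio $r>C$ would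
  -- force growth at least like $r^n$, against the bound $MC^n$.
  by_contra! hlt
  have h1 : 0 < b 1 := (mul_nonneg hC h0.le).trans_lt hlt
  set r := b 1 / b 0 with hr
  have hr0 : 0 < r := div_pos h1 h0
  have hstep : ∀ n, 0 < b n ∧ r * b n ≤ b (n + 1) := by
    intro n
    induction n with
    | zero => exact ⟨h0, by rw [hr, div_mul_cancel₀ _ h0.ne']⟩
    | succ n ih =>
      have hp : 0 < b (n + 1) := (mul_pos hr0 ih.1).trans_le ih.2
      refine ⟨hp, ?_⟩
      have h2 := hconv n
      have h3 : b n * (r * b (n + 1)) ≤ b n * b (n + 2) := by nlinarith [ih.2]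
      exact le_of_mul_le_mul_left h3 ih.1
  have hpow : ∀ n, b 0 * r ^ n ≤ b n := by
    intro n
    induction n with
    | zero => simp
    | succ n ih =>
      refine le_trans ?_ (hstep n).2
      rw [pow_succ]
      nlinarith
  have hCr : C < r := by rwa [hr, lt_div_iff₀ h0]
  have hq : C / r < 1 := (div_lt_one hr0).2 hCr
  have hlim : Tendsto (fun n : ℕ => M * (C / r) ^ n) atTop (𝓝 (M * 0)) :=
    (tendsto_pow_atTop_nhds_zero_of_lt_one (div_nonneg hC hr0.le) hq).const_mul M
  have hge : b 0 ≤ M * 0 := ge_of_tendsto' hlim fun n => by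
    rw [div_pow, ← mul_div_assoc, le_div_iff₀ (pow_pos hr0 n)]
    exact (hpow n).trans (hgrow n)
  linarith

section SelfAdjoint

variable {E : Type*} [NormedAddCommGroup E] [InnerProductSpace ℂ E] [CompleteSpace E]

/-- The kernel of a self-adjoint operator is orthogonal to its range, so surjectivity gives
injectivity, and a bijective bounded operator has a bounded inverse. -/
theorem isUnit_of_surjective {L : E →L[ℂ] E} (hL : IsSelfAdjoint L)
    (hs : Function.Surjective L) : IsUnit L := by
  rw [ContinuousLinearMap.isUnit_iff_bijective]
  refine ⟨(injective_iff_map_eq_zero _).2 fun u hu => ?_, hs⟩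
  obtain ⟨v, rfl⟩ := hs u
  have h := hL.isSymmetric v (L v)
  have h' : inner ℂ (L v) (L v) = (0 : ℂ) := by
    refine h.trans ?_
    change inner ℂ v (L (L v)) = 0
    rw [hu, inner_zero_right]
  exact inner_self_eq_zero.1 h'

/-- The number $(1+z)^{-1}$ is not real, hence lies outside the spectrum of `K`. Multiplying
$(1+z)^{-1}-K$ by $1+z$ gives the claim. -/
theorem isUnit_one_sub_smul_of_im_ne_zero {K : E →L[ℂ] E} (hK : IsSelfAdjoint K) {z : ℂ}
    (hz : z.im ≠ 0) : IsUnit (1 - (1 + z) • K) := by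
  have hz1 : 1 + z ≠ 0 := fun h => hz (by simpa using congrArg Complex.im h)
  have hnot : (1 + z)⁻¹ ∉ spectrum ℂ K := by
    intro hmem
    have h := congrArg Complex.im (hK.mem_spectrum_eq_re hmem)
    rw [Complex.inv_im, Complex.ofReal_im, div_eq_zero_iff] at h
    rcases h with h | h
    · exact hz (by simpa using h)
    · exact hz1 (Complex.normSq_eq_zero.1 h)
  have hu := spectrum.notMem_iff.1 hnot
  have h2 := (Units.mk0 _ hz1).isUnit.map (algebraMap ℂ (E →L[ℂ] E)) |>.mul hu
  convert h2 using 1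
  rw [Units.val_mk0, mul_sub, ← map_mul, mul_inv_cancel₀ hz1, map_one, Algebra.smul_def]

/-- An operator on a normed space `V` that is an inverse of `A - z` on the image of `V` in the
Hilbert space is bounded with respect to the Hilbert space norm (a theorem of Krein and Lax), so
that `A - z` is invertible. Here `A` is given through `K = (A + 1)⁻¹`. -/
theorem isUnit_one_sub_smul_of_dense {K : E →L[ℂ] E} (hK : IsSelfAdjoint K)
    {z : ℂ} (hz : z.im = 0) {V : Type*} [NormedAddCommGroup V]
    (j : V →+ E) (hj : DenseRange j) (T : V →+ V) {M C : ℝ} (hC : 0 ≤ C)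
    (hjM : ∀ v, ‖j v‖ ≤ M * ‖v‖) (hTC : ∀ v, ‖T v‖ ≤ C * ‖v‖)
    (h : ∀ v, K (j v + (1 + z) • j (T v)) = j (T v)) : IsUnit (1 - (1 + z) • K) := by
  have hzc : conj (1 + z) = 1 + z := Complex.conj_eq_iff_im.2 (by simpa using hz)
  have hL : IsSelfAdjoint (1 - (1 + z) • K) := by
    refine (IsSelfAdjoint.one _).sub ?_
    exact IsSelfAdjoint.smul hzc hK
  have hsymmK : ∀ x y, inner ℂ (K x) y = inner ℂ x (K y) := fun x y => hK.isSymmetric x y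
  -- `T` is symmetric for the inner product pulled back along `j`: evaluate $\langle
  -- K(jv+(1+z)jTv),\,jw+(1+z)jTw\rangle$ with `K` on either side. The common term cancels because
  -- $1+z$ is real.
  have hsymm : ∀ v w, inner ℂ (j (T v)) (j w) = inner ℂ (j v) (j (T w)) := by
    intro v w
    have e1 := congrArg (fun x => inner ℂ (j v + (1 + z) • j (T v)) x) (h w)
    have e2 := congrArg (fun x => inner ℂ x (j w + (1 + z) • j (T w))) (h v)
    beta_reduce at e1 e2
    rw [hsymmK, e1, inner_add_left, inner_add_right, inner_smul_left, inner_smul_right, hzc] at e2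
    exact (add_right_cancel e2).symm
  -- Symmetry and Cauchy–Schwarz make $\|jT^nv\|$ log-convex in $n$, while the norm of `V` bounds
  -- its growth by a multiple of $C^n$.
  have hbound : ∀ v, ‖j (T v)‖ ≤ C * ‖j v‖ := by
    intro v
    refine le_mul_of_logConvex (b := fun n => ‖j (T^[n] v)‖) (M := |M| * ‖v‖)
      (fun n => norm_nonneg _) hC (fun n => ?_) fun n => ?_
    · have e : ‖j (T^[n + 1] v)‖ ^ 2 = ‖inner ℂ (j (T^[n] v)) (j (T^[n + 2] v))‖ := by
        rw [Function.iterate_succ_apply' T (n + 1), ← hsymm, ← Function.iterate_succ_apply' T n,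
          inner_self_eq_norm_sq_to_K]
        simp
      rw [e]
      exact norm_inner_le_norm _ _
    · have hT : ∀ n, ‖T^[n] v‖ ≤ C ^ n * ‖v‖ := by
        intro n
        induction n with
        | zero => simp
        | succ n ih =>
          rw [Function.iterate_succ_apply', pow_succ', mul_assoc]
          exact (hTC _).trans (mul_le_mul_of_nonneg_left ih hC)
      calc ‖j (T^[n] v)‖ ≤ M * ‖T^[n] v‖ := hjM _
        _ ≤ |M| * (C ^ n * ‖v‖) :=
          mul_le_mul (le_abs_self M) (hT n) (norm_nonneg _) (abs_nonneg M)
        _ = |M| * ‖v‖ * C ^ n := by ring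
  -- For $jv_n\to f$, the bound just proved gives a limit $u$ of $jTv_n$ with $K(f+(1+z)u)=u$, so
  -- $f+(1+z)u$ is a preimage of $f$.
  refine isUnit_of_surjective hL fun f => ?_
  obtain ⟨s, hsr, hs⟩ := mem_closure_iff_seq_limit.1 (hj f)
  choose v hv using hsr
  obtain rfl : (fun n => j (v n)) = s := funext hv
  have hcau : CauchySeq fun n => j (T (v n)) := by
    have hs' := hs.cauchySeq
    rw [Metric.cauchySeq_iff] at hs' ⊢
    intro ε hε
    obtain ⟨N, hN⟩ := hs' (ε / (C + 1)) (by positivity)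
    refine ⟨N, fun a ha b hb => ?_⟩
    have h1 := hN a ha b hb
    rw [dist_eq_norm, ← map_sub] at h1
    rw [dist_eq_norm, ← map_sub, ← map_sub]
    rw [lt_div_iff₀ (by positivity)] at h1
    have h2 := hbound (v a - v b)
    nlinarith [norm_nonneg (j (v a - v b))]
  obtain ⟨u, hu⟩ := cauchySeq_tendsto_of_complete hcau
  have hKu : K (f + (1 + z) • u) = u :=
    tendsto_nhds_unique (((K.continuous.tendsto _).comp (hs.add (hu.const_smul (1 + z)))).congr
      fun n => h (v n)) hu
  refine ⟨f + (1 + z) • u, ?_⟩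
  simp [hKu]

end SelfAdjoint

/-! ## The generator of `e^{-tA}` -/

section Generator

/-- The function `x ↦ e^{-t(1/x - 1)}`, which gives `e^{-tA}` as a function of `(A + 1)⁻¹`. -/
noncomputable def expNegFun (t x : ℝ) : ℝ := if x = 0 then 0 else Real.exp (-t * (x⁻¹ - 1))

/-- The function that gives `t⁻¹ (e^{-tA} - 1) (A + 1)⁻¹` as a function of `(A + 1)⁻¹`. -/
noncomputable def expNegQuot (t x : ℝ) : ℝ := t⁻¹ * (expNegFun t x * x - x)

/-- Only $x=0$ is delicate: since $t>0$, the exponent tends to $-\infty$ as $x\downarrow0$, which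
matches the value $0$ assigned there. -/
theorem continuousOn_expNegFun {t : ℝ} (ht : 0 < t) :
    ContinuousOn (expNegFun t) (Set.Icc 0 1) := by
  intro x hx
  rcases hx.1.eq_or_lt with rfl | hx0
  · rw [← continuousWithinAt_sdiff_self]
    have h1 : Tendsto (fun x : ℝ => Real.exp (-t * (x⁻¹ - 1))) (𝓝[>] 0) (𝓝 0) := by
      refine Real.tendsto_exp_atBot.comp ?_
      refine Tendsto.const_mul_atTop_of_neg (neg_lt_zero.2 ht) ?_
      exact tendsto_atTop_add_const_right _ _ tendsto_inv_nhdsGT_zero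
    have h2 : Tendsto (expNegFun t) (𝓝[>] 0) (𝓝 0) := by
      refine h1.congr' ?_
      filter_upwards [self_mem_nhdsWithin] with y hy
      rw [expNegFun, if_neg (ne_of_gt hy)]
    have h0 : expNegFun t 0 = 0 := if_pos rfl
    unfold ContinuousWithinAt
    rw [h0]
    exact h2.mono_left (nhdsWithin_mono _ fun y hy => lt_of_le_of_ne hy.1.1 (Ne.symm hy.2))
  · refine ContinuousAt.continuousWithinAt ?_
    have h1 : ContinuousAt (fun x : ℝ => Real.exp (-t * (x⁻¹ - 1))) x := by
      have := continuousAt_inv₀ hx0.ne'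
      fun_prop
    refine h1.congr ?_
    filter_upwards [lt_mem_nhds hx0] with y hy
    rw [expNegFun, if_neg (ne_of_gt hy)]

theorem continuousOn_expNegQuot {t : ℝ} (ht : 0 < t) :
    ContinuousOn (expNegQuot t) (Set.Icc 0 1) :=
  (((continuousOn_expNegFun ht).mul continuousOn_id).sub continuousOn_id).const_mul _

/-- Put $y=t(1/x-1)\ge0$, so that $xy=t(1-x)$, and use $1-y\le e^{-y}\le1-y+y^2$. As $t\downarrow0$
the quotient tends to $x-1$; the additional factor $x$ makes this uniform on $[0,1]$ with rate $t$.
-/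
theorem expNegQuot_bounds {t x : ℝ} (ht : 0 < t) (hx : x ∈ Set.Icc (0 : ℝ) 1) :
    |expNegQuot t x| ≤ 1 ∧ |x * expNegQuot t x - x * (x - 1)| ≤ t := by
  rcases hx.1.eq_or_lt with rfl | hx0
  · simp [expNegQuot, ht.le]
  have e : expNegQuot t x = t⁻¹ * (x * (Real.exp (-t * (x⁻¹ - 1)) - 1)) := by
    rw [expNegQuot, expNegFun, if_neg hx0.ne']
    ring
  set y := t * (x⁻¹ - 1) with hy
  have hxy : x * y = t * (1 - x) := by
    rw [hy]
    field_simp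
  have hy0 : 0 ≤ y := mul_nonneg ht.le (sub_nonneg.2 ((one_le_inv₀ hx0).2 hx.2))
  set w := Real.exp (-t * (x⁻¹ - 1)) with hw
  have hwy : w = Real.exp (-y) := by rw [hw, hy, neg_mul]
  have h1 : w ≤ 1 := by
    rw [hwy]
    exact Real.exp_le_one_iff.2 (neg_nonpos.2 hy0)
  have h2 : 1 - y ≤ w := by
    rw [hwy]
    linarith [Real.add_one_le_exp (-y)]
  have h3 : w ≤ 1 - y + y ^ 2 := by
    have h4 : w * (1 + y) ≤ 1 := by
      calc w * (1 + y) ≤ w * Real.exp y := by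
            refine mul_le_mul_of_nonneg_left ?_ (Real.exp_pos _).le
            linarith [Real.add_one_le_exp y]
        _ = 1 := by rw [hwy, ← Real.exp_add, neg_add_cancel, Real.exp_zero]
    have h5 : w * (1 + y) ≤ (1 - y + y ^ 2) * (1 + y) := by nlinarith [pow_nonneg hy0 3]
    exact le_of_mul_le_mul_right h5 (by linarith)
  have hg : t * expNegQuot t x = x * (w - 1) := by
    rw [e]
    field_simp
  constructor
  · rw [abs_le]
    constructor
    · refine le_of_mul_le_mul_left ?_ ht
      rw [hg]
      nlinarith
    · refine le_of_mul_le_mul_left ?_ ht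
      rw [hg]
      nlinarith
  · have h6 : t * (x * expNegQuot t x - x * (x - 1)) = x ^ 2 * (w - 1 + y) := by
      have : t * (x * (x - 1)) = - (x * (x * y)) := by rw [hxy]; ring
      rw [mul_sub, this, mul_left_comm, hg]
      ring
    have h7 : x ^ 2 * (w - 1 + y) ≤ t * t := by
      calc x ^ 2 * (w - 1 + y) ≤ x ^ 2 * y ^ 2 :=
            mul_le_mul_of_nonneg_left (by linarith) (sq_nonneg x)
        _ = t * t * (1 - x) ^ 2 := by rw [← mul_pow, hxy]; ring
        _ ≤ t * t * 1 := by
            refine mul_le_mul_of_nonneg_left ?_ (mul_pos ht ht).le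
            nlinarith [hx.2]
        _ = t * t := mul_one _
    rw [abs_of_nonneg]
    · refine le_of_mul_le_mul_left ?_ ht
      rwa [h6]
    · refine nonneg_of_mul_nonneg_right ?_ ht
      rw [h6]
      exact mul_nonneg (sq_nonneg x) (by linarith)

variable {E : Type*} [NormedAddCommGroup E] [InnerProductSpace ℂ E] [CompleteSpace E]

/-- Composing the difference quotient with `K` on either side regularises it into a continuous
function of `K`, which the bounded functional calculus controls. -/
theorem expNeg_quotient {A : E →ₗ.[ℂ] E} {K : E →L[ℂ] E} (hA : A.IsResolvent (-1) K)
    (hK : IsSelfAdjoint K) (hspec : spectrum ℝ K ⊆ Set.Icc 0 1) {t : ℝ≥0} (ht : 0 < t) :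
    (((t : ℝ) : ℂ)⁻¹ • (expNeg A t - 1)) * K = cfc (expNegQuot t) K ∧
      K * (((t : ℝ) : ℂ)⁻¹ • (expNeg A t - 1)) = cfc (expNegQuot t) K := by
  have ht' : (0 : ℝ) < t := ht
  have hS : expNeg A t = cfc (expNegFun t) K := by
    rw [expNeg, if_neg ht.ne', hA.res_eq]
    rfl
  have hc := (continuousOn_expNegFun ht').mono hspec
  have hmul : cfc (expNegFun t) K * K = cfc (fun x => expNegFun t x * x) K := by
    rw [cfc_mul (expNegFun t) (fun x => x) K hc continuousOn_id, cfc_id' ℝ K]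
  have hq : cfc (expNegQuot t) K = (t : ℝ)⁻¹ • (cfc (expNegFun t) K * K - K) := by
    have hc' : ContinuousOn (fun x => expNegFun t x * x) (spectrum ℝ K) :=
      hc.mul continuousOn_id
    have hsub : cfc (fun x => expNegFun t x * x) K - K =
        cfc (fun x => expNegFun t x * x - x) K := by
      rw [cfc_sub _ (fun x => x) K hc' continuousOn_id, cfc_id' ℝ K]
    rw [hmul, hsub, ← cfc_smul _ (fun x => expNegFun t x * x - x) K (hc'.sub continuousOn_id)]
    rfl
  have hcomm : cfc (expNegFun t) K * K = K * cfc (expNegFun t) K := by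
    have h := (cfc_commute_cfc (expNegFun t) id K).eq
    rwa [cfc_id ℝ K] at h
  have hsm : ∀ B : E →L[ℂ] E, ((t : ℝ) : ℂ)⁻¹ • B = (t : ℝ)⁻¹ • B := fun B => by
    rw [← Complex.ofReal_inv]
    exact Complex.coe_smul _ _
  rw [hS, hq, hsm]
  constructor
  · rw [smul_mul_assoc, sub_mul, one_mul]
  · rw [mul_smul_comm, mul_sub, mul_one, hcomm]

/-- The operators are uniformly bounded and converge, with rate $t$, on the range of `K`. That range
is dense because `K` is self-adjoint and injective. -/
theorem tendsto_expNegQuot {K : E →L[ℂ] E} (hK : IsSelfAdjoint K)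
    (hinj : Function.Injective K) (hspec : spectrum ℝ K ⊆ Set.Icc 0 1) (v : E) :
    Tendsto (fun t : ℝ≥0 => cfc (expNegQuot t) K v) (𝓝[>] 0) (𝓝 (K v - v)) := by
  have hpos : ∀ᶠ t : ℝ≥0 in 𝓝[>] 0, 0 < t := self_mem_nhdsWithin
  have hbound : ∀ t : ℝ≥0, 0 < t → ‖cfc (expNegQuot t) K‖ ≤ 1 := fun t ht =>
    norm_cfc_le zero_le_one fun x hx => (expNegQuot_bounds (NNReal.coe_pos.2 ht) (hspec hx)).1
  have hK1 : ‖K‖ ≤ 1 := by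
    rw [← cfc_id ℝ K]
    refine norm_cfc_le zero_le_one fun x hx => ?_
    exact abs_le.2 ⟨by linarith [(hspec hx).1, show id x = x from rfl], (hspec hx).2⟩
  have hrange : ∀ t : ℝ≥0, 0 < t → ‖cfc (expNegQuot t) K * K - (K - 1) * K‖ ≤ t := by
    intro t ht
    have ht' : (0 : ℝ) < t := ht
    have hc := (continuousOn_expNegQuot ht').mono hspec
    have e : cfc (expNegQuot t) K * K - (K - 1) * K =
        cfc (fun x => x * expNegQuot t x - x * (x - 1)) K := by
      have hc1 : ContinuousOn (fun x => x * expNegQuot t x) (spectrum ℝ K) :=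
        continuousOn_id.mul hc
      have hc2 : ContinuousOn (fun x : ℝ => x - 1) (spectrum ℝ K) := by fun_prop
      have hc3 : ContinuousOn (fun x : ℝ => x * (x - 1)) (spectrum ℝ K) := by fun_prop
      rw [cfc_sub _ _ K hc1 hc3, cfc_mul (fun x => x) _ K continuousOn_id hc,
        cfc_mul (fun x => x) (fun x => x - 1) K continuousOn_id hc2,
        cfc_sub (fun x => x) (fun _ => 1) K continuousOn_id continuousOn_const,
        cfc_const_one ℝ K, cfc_id' ℝ K]
      have h := (cfc_commute_cfc (expNegQuot t) id K).eq
      rw [cfc_id ℝ K] at h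
      rw [h, sub_mul, mul_sub, one_mul, mul_one]
    rw [e]
    exact norm_cfc_le ht'.le fun x hx => (expNegQuot_bounds ht' (hspec hx)).2
  have hdense : DenseRange K := by
    rw [DenseRange, ← ContinuousLinearMap.coe_coe, ← LinearMap.coe_range,
      Submodule.dense_iff_topologicalClosure_eq_top, Submodule.topologicalClosure_eq_top_iff]
    rw [ContinuousLinearMap.orthogonal_range, hK.adjoint_eq]
    exact LinearMap.ker_eq_bot.2 hinj
  rw [Metric.tendsto_nhds]
  intro ε hε
  -- Three error terms of size at most $\|v-Kw\|$ and one of size $t\|w\|$ will appear, hence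
  -- $\varepsilon/6$ here and $\varepsilon/2$ below.
  obtain ⟨w, hw⟩ := hdense.exists_dist_lt v (show 0 < ε / 6 by positivity)
  rw [dist_eq_norm] at hw
  have hsmall : ∀ᶠ t : ℝ≥0 in 𝓝[>] 0, (t : ℝ) * ‖w‖ < ε / 2 := by
    have h : Tendsto (fun t : ℝ≥0 => (t : ℝ) * ‖w‖) (𝓝 0) (𝓝 (((0 : ℝ≥0) : ℝ) * ‖w‖)) :=
      (NNReal.continuous_coe.mul continuous_const).tendsto 0
    rw [NNReal.coe_zero, zero_mul] at h
    exact nhdsWithin_le_nhds (h.eventually_lt_const (by positivity))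
  filter_upwards [hpos, hsmall] with t ht hts
  rw [dist_eq_norm]
  set B := cfc (expNegQuot t) K with hB
  have e : B v - (K v - v) =
      B (v - K w) - K (v - K w) + (v - K w) + (B * K - (K - 1) * K) w := by
    simp only [map_sub, sub_apply, mul_apply_eq_comp,
      one_apply_eq_self]
    abel
  have i1 : ‖B (v - K w)‖ ≤ ‖v - K w‖ := by
    simpa using B.le_of_opNorm_le (hbound t ht) (v - K w)
  have i2 : ‖K (v - K w)‖ ≤ ‖v - K w‖ := by
    simpa using K.le_of_opNorm_le hK1 (v - K w)
  have i3 := ContinuousLinearMap.le_of_opNorm_le _ (hrange t ht) w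
  rw [e]
  have i4 := norm_add_le (B (v - K w) - K (v - K w) + (v - K w)) ((B * K - (K - 1) * K) w)
  have i5 := norm_add_le (B (v - K w) - K (v - K w)) (v - K w)
  have i6 := norm_sub_le (B (v - K w)) (K (v - K w))
  linarith

/-- The generator of `e^{-tA}` is `-A`, where `A` is given through `K = (A + 1)⁻¹`. -/
theorem tendsto_expNeg_iff {A : E →ₗ.[ℂ] E} {K : E →L[ℂ] E} (hA : A.IsResolvent (-1) K)
    (hK : IsSelfAdjoint K) (hspec : spectrum ℝ K ⊆ Set.Icc 0 1) {f g : E} :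
    Tendsto (fun t : ℝ≥0 => ((t : ℝ) : ℂ)⁻¹ • (expNeg A t f - f)) (𝓝[>] 0) (𝓝 (-g)) ↔
      K (g + f) = f := by
  have hpos : ∀ᶠ t : ℝ≥0 in 𝓝[>] 0, 0 < t := self_mem_nhdsWithin
  constructor
  · intro h
    -- Applying `K` to the difference quotient gives the limit $-Kg$, while the functional calculus
    -- gives $Kf-f$.
    have h1 : Tendsto (fun t : ℝ≥0 => cfc (expNegQuot t) K f) (𝓝[>] 0) (𝓝 (K (-g))) := by
      refine ((K.continuous.tendsto _).comp h).congr' ?_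
      filter_upwards [hpos] with t ht
      rw [← (expNeg_quotient hA hK hspec ht).2]
      rfl
    have h2 := tendsto_nhds_unique h1 (tendsto_expNegQuot hK hA.injective hspec f)
    rw [map_neg, eq_sub_iff_add_eq] at h2
    rw [map_add, ← h2]
    abel
  · intro h
    have h1 := tendsto_expNegQuot hK hA.injective hspec (g + f)
    rw [h, show f - (g + f) = -g by abel] at h1
    refine h1.congr' ?_
    filter_upwards [hpos] with t ht
    rw [← (expNeg_quotient hA hK hspec ht).1, mul_apply_eq_comp, h]
    rfl

end Generator

section SemigroupGenerator

variable {E : Type*} [NormedAddCommGroup E] [NormedSpace ℂ E]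

theorem semigroupGenerator_apply_eq_iff {T : ℝ≥0 → E →L[ℂ] E} {f g : E} :
    (∃ hf : f ∈ (semigroupGenerator T).domain, semigroupGenerator T ⟨f, hf⟩ = g) ↔
      Tendsto (fun t : ℝ≥0 => ((t : ℝ) : ℂ)⁻¹ • (T t f - f)) (𝓝[>] 0) (𝓝 g) := by
  constructor
  · rintro ⟨hf, rfl⟩
    exact hf.choose_spec
  · intro h
    exact ⟨⟨g, h⟩, tendsto_nhds_unique (Exists.choose_spec (⟨g, h⟩ : ∃ g, Tendsto _ _ (𝓝 g))) h⟩

end SemigroupGenerator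

/-! ## The resolvent of the operator associated with a closable form -/

namespace PositiveForm

variable {E : Type*} [NormedAddCommGroup E] [InnerProductSpace ℂ E] (q : PositiveForm E)

/-- The map `u ↦ (u, u)` from the domain of a form to the product of the Hilbert space and the
completion with respect to the form. -/
noncomputable def diag :
    q.dom →ₗ[ℂ] WithLp 2 (E × UniformSpace.Completion q.Space) where
  toFun u := WithLp.toLp 2 ((u : E), q.toCompl u)
  map_add' u v := by rw [q.toCompl_add]; rfl
  map_smul' c u := by rw [q.toCompl_smul]; rfl

/-- The domain of the closure of a form with the norm of the form plus the norm of the Hilbert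
space, as a closed subspace of a product of Hilbert spaces. -/
noncomputable def closedDom : Submodule ℂ (WithLp 2 (E × UniformSpace.Completion q.Space)) :=
  q.diag.range.topologicalClosure

theorem mem_closedDom_iff {w : WithLp 2 (E × UniformSpace.Completion q.Space)} :
    w ∈ q.closedDom ↔ ∃ u : ℕ → q.dom, Tendsto (fun n => (u n : E)) atTop (𝓝 w.fst) ∧
      Tendsto (fun n => q.toCompl (u n)) atTop (𝓝 w.snd) := by
  rw [closedDom, ← SetLike.mem_coe, Submodule.topologicalClosure_coe, mem_closure_iff_seq_limit]
  constructor
  · rintro ⟨s, hs, hlim⟩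
    choose u hu using hs
    obtain rfl : (fun n => q.diag (u n)) = s := funext hu
    exact ⟨u, ((WithLp.continuous_fst 2 _ _).tendsto _).comp hlim,
      ((WithLp.continuous_snd 2 _ _).tendsto _).comp hlim⟩
  · rintro ⟨u, h1, h2⟩
    refine ⟨fun n => q.diag (u n), fun n => ⟨u n, rfl⟩, ?_⟩
    exact ((WithLp.prod_continuous_toLp 2 _ _).tendsto (w.fst, w.snd)).comp (h1.prodMk_nhds h2)

theorem exists_closedDom_of_mem {f : E} (hf : f ∈ q.closureDom) :
    ∃ w ∈ q.closedDom, w.fst = f := by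
  obtain ⟨u, h1, h2⟩ := hf
  obtain ⟨U, hU⟩ := (q.isFormCauchy_iff u).1 h2
  exact ⟨WithLp.toLp 2 (f, U), q.mem_closedDom_iff.2 ⟨u, h1, hU⟩, rfl⟩

theorem fst_mem_closureDom {w : WithLp 2 (E × UniformSpace.Completion q.Space)}
    (hw : w ∈ q.closedDom) : w.fst ∈ q.closureDom := by
  obtain ⟨u, h1, h2⟩ := q.mem_closedDom_iff.1 hw
  exact ⟨u, h1, (q.isFormCauchy_iff u).2 ⟨_, h2⟩⟩

variable {q}

/-- Sequences defining points of `closedDom` are approximating sequences for the form. By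
closability they compute `closureForm`, and their form values tend to the inner product of the
second components. -/
theorem closureForm_eq_inner (hcl : q.IsClosable)
    {w w' : WithLp 2 (E × UniformSpace.Completion q.Space)} (hw : w ∈ q.closedDom)
    (hw' : w' ∈ q.closedDom) (h : w.fst ∈ q.closureDom) (h' : w'.fst ∈ q.closureDom) :
    q.closureForm ⟨w.fst, h⟩ ⟨w'.fst, h'⟩ = inner ℂ w'.snd w.snd := by
  obtain ⟨u, h1, h2⟩ := q.mem_closedDom_iff.1 hw
  obtain ⟨u', h1', h2'⟩ := q.mem_closedDom_iff.1 hw'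
  refine tendsto_nhds_unique (IsApprox.tendsto_closureForm hcl (f := ⟨w.fst, h⟩)
    (g := ⟨w'.fst, h'⟩) ⟨h1, (q.isFormCauchy_iff u).2 ⟨_, h2⟩⟩
    ⟨h1', (q.isFormCauchy_iff u').2 ⟨_, h2'⟩⟩) ?_
  refine (h2'.inner (𝕜 := ℂ) h2).congr fun n => ?_
  exact q.toCompl_inner _ _

variable (q)

theorem operator_apply_eq_iff (hd : Dense (q.dom : Set E)) {f g : E} :
    (∃ hf : f ∈ (q.operator hd).domain, q.operator hd ⟨f, hf⟩ = g) ↔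
      ∃ hf : f ∈ q.dom, ∀ h : q.dom, q.form ⟨f, hf⟩ h = inner ℂ (h : E) g := by
  constructor
  · rintro ⟨hf, rfl⟩
    exact ⟨hf.choose, fun h => q.operatorFun_spec ⟨f, hf⟩ h⟩
  · rintro ⟨hf, hg⟩
    refine ⟨⟨hf, g, hg⟩, hd.eq_of_inner_right ℂ fun h hh => ?_⟩
    exact (q.operatorFun_spec ⟨f, hf, g, hg⟩ ⟨h, hh⟩).symm.trans (hg ⟨h, hh⟩)

/-- The projection of the domain of the closure of a form to the Hilbert space. -/
noncomputable def closedDomProj : q.closedDom →L[ℂ] E :=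
  (WithLp.fstL 2 ℂ E (UniformSpace.Completion q.Space)).comp q.closedDom.subtypeL

theorem closedDomProj_apply (w : q.closedDom) :
    q.closedDomProj w = (w : WithLp 2 (E × UniformSpace.Completion q.Space)).fst := rfl

theorem norm_closedDomProj_le : ‖q.closedDomProj‖ ≤ 1 := by
  refine ContinuousLinearMap.opNorm_le_bound _ zero_le_one fun w => ?_
  rw [one_mul]
  exact WithLp.norm_fst_le _ (w : WithLp 2 (E × UniformSpace.Completion q.Space))

variable [CompleteSpace E]

instance : CompleteSpace q.closedDom :=
  q.diag.range.isClosed_topologicalClosure.completeSpace_coe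

/-- The resolvent `(A + 1)⁻¹` of the operator `A` associated with the closure of a form. -/
noncomputable def resolvent : E →L[ℂ] E :=
  q.closedDomProj.comp (ContinuousLinearMap.adjoint q.closedDomProj)

theorem isPositive_resolvent : q.resolvent.IsPositive :=
  ContinuousLinearMap.isPositive_self_comp_adjoint _

theorem norm_resolvent_le : ‖q.resolvent‖ ≤ 1 := by
  refine (ContinuousLinearMap.opNorm_comp_le _ _).trans ?_
  rw [LinearIsometryEquiv.norm_map]
  exact mul_le_one₀ q.norm_closedDomProj_le (norm_nonneg q.closedDomProj) q.norm_closedDomProj_le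

theorem spectrum_resolvent : spectrum ℝ q.resolvent ⊆ Set.Icc 0 1 := by
  intro x hx
  have h0 : 0 ≤ q.resolvent :=
    (ContinuousLinearMap.nonneg_iff_isPositive _).2 q.isPositive_resolvent
  refine ⟨spectrum_nonneg_of_nonneg h0 hx, ?_⟩
  -- The bound of the spectrum by the norm requires $\|1\|=1$; on the trivial space the spectrum is
  -- empty.
  rcases subsingleton_or_nontrivial E with h | h
  · exact absurd hx (by simp [spectrum.of_subsingleton])
  · exact (le_abs_self x).trans ((spectrum.norm_le_norm_of_mem hx).trans q.norm_resolvent_le)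

/-- The inner product of `closedDom` is that of the Hilbert space plus the form. Hence the weak
equation $q(f,h)=\langle g,h\rangle$, after adding $\langle f,h\rangle$, says that $J^*(g+f)$ is the
point of `closedDom` above $f$, where $J$ is `closedDomProj`. -/
theorem operator_closure_apply_eq_iff (hcl : q.IsClosable)
    (hd : Dense ((q.closure hcl).dom : Set E)) {f g : E} :
    (∃ hf : f ∈ ((q.closure hcl).operator hd).domain,
      (q.closure hcl).operator hd ⟨f, hf⟩ = g) ↔ q.resolvent (g + f) = f := by
  rw [operator_apply_eq_iff]
  constructor
  · rintro ⟨hf, hg⟩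
    obtain ⟨w, hw, rfl⟩ := q.exists_closedDom_of_mem hf
    have e : ContinuousLinearMap.adjoint q.closedDomProj (g + w.fst) = ⟨w, hw⟩ := by
      refine ext_inner_left ℂ fun w' => ?_
      rw [ContinuousLinearMap.adjoint_inner_right, closedDomProj_apply, inner_add_right]
      have h1 := hg ⟨_, q.fst_mem_closureDom w'.2⟩
      have h2 := closureForm_eq_inner hcl hw w'.2 hf (q.fst_mem_closureDom w'.2)
      rw [← h1, Submodule.coe_inner, WithLp.prod_inner_apply, add_comm]
      exact congrArg₂ _ rfl h2
    change q.closedDomProj (ContinuousLinearMap.adjoint q.closedDomProj (g + w.fst)) = w.fst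
    rw [e]
    rfl
  · intro h
    set w := ContinuousLinearMap.adjoint q.closedDomProj (g + f) with hw
    have hwf : (w : WithLp 2 (E × UniformSpace.Completion q.Space)).fst = f := h
    have hf : f ∈ q.closureDom := hwf ▸ q.fst_mem_closureDom w.2
    refine ⟨hf, ?_⟩
    rintro ⟨f', hf'⟩
    obtain ⟨w', hw', rfl⟩ := q.exists_closedDom_of_mem hf'
    have h1 := ContinuousLinearMap.adjoint_inner_right q.closedDomProj ⟨w', hw'⟩ (g + f)
    rw [← hw, closedDomProj_apply, inner_add_right, Submodule.coe_inner,
      WithLp.prod_inner_apply] at h1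
    have h2 := closureForm_eq_inner hcl w.2 hw' (q.fst_mem_closureDom w.2) hf'
    have h3 : q.closureForm ⟨f, hf⟩ ⟨w'.fst, hf'⟩ = inner ℂ w'.snd w.1.snd := by
      rw [← h2]
      congr 1
      exact Subtype.ext hwf.symm
    refine h3.trans ?_
    have h4 : inner ℂ w'.fst w.1.fst + inner ℂ w'.snd w.1.snd =
      inner ℂ w'.fst g + inner ℂ w'.fst f := h1
    rw [hwf, add_comm] at h4
    exact add_right_cancel h4

theorem isResolvent_operator_closure (hcl : q.IsClosable)
    (hd : Dense ((q.closure hcl).dom : Set E)) :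
    ((q.closure hcl).operator hd).IsResolvent (-1) q.resolvent := by
  constructor
  · intro f
    have h : q.resolvent ((f - q.resolvent f) + q.resolvent f) = q.resolvent f := by
      rw [sub_add_cancel]
    obtain ⟨hd', he⟩ := (q.operator_closure_apply_eq_iff hcl hd).2 h
    exact ⟨hd', by rw [he, neg_one_smul, sub_neg_eq_add, sub_add_cancel]⟩
  · rintro ⟨u, hu⟩
    have h := (q.operator_closure_apply_eq_iff hcl hd).1 ⟨hu, rfl⟩
    rwa [neg_one_smul, sub_neg_eq_add]

end PositiveForm

/-! ## Spectral inclusion for consistent semigroups -/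

section SpectralInclusion

variable {E : Type*} [NormedAddCommGroup E] [InnerProductSpace ℂ E] [CompleteSpace E]
  {F : Type*} [NormedAddCommGroup F] [NormedSpace ℂ F]

theorem neg_semigroupGenerator_apply_eq_iff {T : ℝ≥0 → F →L[ℂ] F} {f g : F} :
    (∃ hf : f ∈ (-semigroupGenerator T).domain, (-semigroupGenerator T) ⟨f, hf⟩ = g) ↔
      Tendsto (fun t : ℝ≥0 => ((t : ℝ) : ℂ)⁻¹ • (T t f - f)) (𝓝[>] 0) (𝓝 (-g)) := by
  rw [← semigroupGenerator_apply_eq_iff]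
  constructor
  · rintro ⟨hf, rfl⟩
    exact ⟨hf, (neg_neg (semigroupGenerator T ⟨f, hf⟩)).symm⟩
  · rintro ⟨hf, h⟩
    exact ⟨hf, (congrArg Neg.neg h).trans (neg_neg g)⟩

/-- If a semigroup on a space `F` that is dense in a Hilbert space is the restriction of `e^{-tA}`,
then the spectrum of `A` is contained in the spectrum of its negative generator. -/
theorem spec_subset_of_restriction {A : E →ₗ.[ℂ] E} {K : E →L[ℂ] E} (hA : A.IsResolvent (-1) K)
    (hK : IsSelfAdjoint K) (hspec : spectrum ℝ K ⊆ Set.Icc 0 1) {T : ℝ≥0 → F →L[ℂ] F}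
    (i : F →L[ℂ] E) (hi : DenseRange i) (hT : ∀ t v, i (T t v) = expNeg A t (i v)) :
    A.spec ⊆ (-semigroupGenerator T).spec := by
  rintro z hz ⟨R, hR, -⟩
  refine hA.notMem_spec ?_ hz
  by_cases hzim : z.im = 0
  · refine isUnit_one_sub_smul_of_dense hK hzim (i : F →+ E) hi (R : F →+ F)
      (norm_nonneg R) i.le_opNorm R.le_opNorm fun v => ?_
    obtain ⟨hd, he⟩ := hR v
    have h1 := neg_semigroupGenerator_apply_eq_iff.1 ⟨hd, eq_add_of_sub_eq he⟩
    -- Continuity of `i` carries the generator limit into the Hilbert space, so that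
    -- $A\,iRv=iv+z\,iRv$.
    have h2 : Tendsto (fun t : ℝ≥0 => ((t : ℝ) : ℂ)⁻¹ • (expNeg A t (i (R v)) - i (R v)))
        (𝓝[>] 0) (𝓝 (-(i v + z • i (R v)))) := by
      have h3 := (i.continuous.tendsto _).comp h1
      rw [map_neg, map_add, map_smul] at h3
      refine h3.congr fun t => ?_
      rw [Function.comp_apply, map_smul, map_sub, hT]
    have h3 := (tendsto_expNeg_iff hA hK hspec).1 h2
    change K (i v + (1 + z) • i (R v)) = i (R v)
    rwa [add_smul, one_smul, add_comm (i (R v)), ← add_assoc]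
  · exact isUnit_one_sub_smul_of_im_ne_zero hK hzim

/-- If `e^{-tA}` is the restriction of a semigroup on a space `F` that contains the Hilbert space,
then the spectrum of `A` is contained in the spectrum of the negative generator on `F`. -/
theorem spec_subset_of_extension {A : E →ₗ.[ℂ] E} {K : E →L[ℂ] E} (hA : A.IsResolvent (-1) K)
    (hK : IsSelfAdjoint K) (hspec : spectrum ℝ K ⊆ Set.Icc 0 1) {T : ℝ≥0 → F →L[ℂ] F}
    (i : E →L[ℂ] F) (hi : Function.Injective i) (hT : ∀ t v, T t (i v) = i (expNeg A t v)) :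
    A.spec ⊆ (-semigroupGenerator T).spec := by
  rintro z hz ⟨R, -, hR⟩
  refine hA.notMem_spec ?_ hz
  by_cases hzim : z.im = 0
  swap
  · exact isUnit_one_sub_smul_of_im_ne_zero hK hzim
  have hzc : conj (1 + z) = 1 + z := Complex.conj_eq_iff_im.2 (by simpa using hzim)
  -- The vector $i(Kx)$ lies in the domain of the generator on `F`, with image determined by
  -- $AKx=x-Kx$. The left inverse property of `R` there gives this identity.
  have hRK : ∀ x, R (i x) = i (K x) + (1 + z) • R (i (K x)) := by
    intro x
    have h1 : K ((x - K x) + K x) = K x := by rw [sub_add_cancel]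
    have h2 := (i.continuous.tendsto _).comp ((tendsto_expNeg_iff hA hK hspec).2 h1)
    have h3 : Tendsto (fun t : ℝ≥0 => ((t : ℝ) : ℂ)⁻¹ • (T t (i (K x)) - i (K x)))
        (𝓝[>] 0) (𝓝 (-i (x - K x))) := by
      rw [map_neg] at h2
      refine h2.congr fun t => ?_
      rw [Function.comp_apply, map_smul, map_sub, hT]
    obtain ⟨hd, he⟩ := neg_semigroupGenerator_apply_eq_iff.2 h3
    have h4 := hR ⟨_, hd⟩
    rw [he, map_sub, map_sub, map_sub, map_smul, sub_sub, sub_eq_iff_eq_add] at h4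
    rwa [add_smul, one_smul]
  -- The Riesz representative of $\varphi\circ i$ depends conjugate-linearly on $\varphi$, so `j` is
  -- treated only as an additive map.
  let j : (F →L[ℂ] ℂ) →+ E :=
    { toFun := fun φ => (InnerProductSpace.toDual ℂ E).symm (φ.comp i)
      map_zero' := by simp
      map_add' := fun φ ψ => by rw [ContinuousLinearMap.add_comp, map_add] }
  have hj : ∀ φ x, inner ℂ (j φ) x = φ (i x) := fun φ x =>
    InnerProductSpace.toDual_symm_apply
  let T' : (F →L[ℂ] ℂ) →+ (F →L[ℂ] ℂ) :=
    { toFun := fun φ => φ.comp R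
      map_zero' := ContinuousLinearMap.zero_comp R
      map_add' := fun φ ψ => ContinuousLinearMap.add_comp φ ψ R }
  refine isUnit_one_sub_smul_of_dense hK hzim j ?_ T' (M := ‖i‖) (norm_nonneg R) ?_ ?_ ?_
  · let W : Submodule ℂ E :=
      { carrier := Set.range j
        add_mem' := by
          rintro _ _ ⟨φ, rfl⟩ ⟨ψ, rfl⟩
          exact ⟨φ + ψ, map_add j φ ψ⟩
        zero_mem' := ⟨0, map_zero j⟩
        smul_mem' := by
          rintro c _ ⟨φ, rfl⟩
          refine ⟨conj c • φ, ?_⟩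
          refine ext_inner_right ℂ fun x => ?_
          rw [hj, inner_smul_left, hj]
          rfl }
    change Dense (W : Set E)
    rw [Submodule.dense_iff_topologicalClosure_eq_top,
      Submodule.topologicalClosure_eq_top_iff, Submodule.eq_bot_iff]
    intro x hx
    -- A vector $x$ orthogonal to the range of `j` satisfies $\varphi(ix)=0$ for all $\varphi$;
    -- functionals separate points and `i` is injective.
    refine hi ?_
    rw [map_zero]
    refine SeparatingDual.eq_zero_of_forall_dual_eq_zero (R := ℂ) fun φ => ?_
    rw [← hj]
    exact (Submodule.mem_orthogonal _ _).1 hx _ ⟨φ, rfl⟩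
  · intro φ
    rw [mul_comm]
    exact (LinearIsometryEquiv.norm_map _ _).trans_le (φ.opNorm_comp_le i)
  · intro φ
    rw [mul_comm]
    exact φ.opNorm_comp_le R
  · intro φ
    refine ext_inner_right ℂ fun x => ?_
    have hs : ∀ a, inner ℂ (K a) x = inner ℂ a (K x) := fun a => hK.isSymmetric a x
    -- Tested against $x$, the required identity is the transpose of `hRK`.
    rw [hs, inner_add_left, inner_smul_left, hj, hj, hj, hzc]
    change φ (i (K x)) + (1 + z) * φ (R (i (K x))) = φ (R (i x))
    rw [hRK x, map_add, map_smul, smul_eq_mul]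

end SpectralInclusion

/-! ## Inclusions between weighted sequence spaces -/

namespace WeightedLp

variable {X : Type*} {m : X → Set.Ioi (0 : ℝ)}

theorem eval_injective (p : ℝ≥0∞) : Function.Injective (eval m p) := by
  intro f g h
  exact Lp.ext (Eventually.of_forall fun x => congrFun h x)

/-- A single point already gives $\delta|f(x)|^p\le\|f\|_p^p$, so $f$ is bounded, and
$|f|^q=(|f|^p)^{q/p-1}|f|^p$ is at most a constant times $|f|^p$. -/
theorem memLp_of_le {δ : ℝ} (hδ : 0 < δ) (hm : ∀ x, δ ≤ (m x : ℝ)) {p q : ℝ≥0∞} (hp : p ≠ 0)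
    (hpq : p ≤ q) (hq : q ≠ ∞) {f : X → ℂ} (hf : @MemLp X ℂ ⊤ _ _ f p (weightMeasure m)) :
    @MemLp X ℂ ⊤ _ _ f q (weightMeasure m) := by
  let _ : MeasurableSpace X := ⊤
  have hp' : p ≠ ∞ := ne_top_of_le_ne_top hq hpq
  have hq' : q ≠ 0 := fun h => hp (le_zero_iff.1 (h ▸ hpq))
  have hp0 : 0 < p.toReal := ENNReal.toReal_pos hp hp'
  have hpqr : p.toReal ≤ q.toReal := ENNReal.toReal_mono hq hpq
  refine ⟨hf.1, ?_⟩
  rw [eLpNorm_lt_top_iff_lintegral_rpow_enorm_lt_top hq' hq]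
  set I := ∫⁻ x, ‖f x‖ₑ ^ p.toReal ∂(weightMeasure m) with hI
  have hIfin : I < ∞ := (eLpNorm_lt_top_iff_lintegral_rpow_enorm_lt_top hp hp').1 hf.2
  have hbound : ∀ x, ‖f x‖ₑ ^ p.toReal ≤ I / ENNReal.ofReal δ := by
    intro x
    rw [ENNReal.le_div_iff_mul_le (Or.inl (ENNReal.ofReal_pos.2 hδ).ne')
      (Or.inl ENNReal.ofReal_ne_top)]
    calc ‖f x‖ₑ ^ p.toReal * ENNReal.ofReal δ
        ≤ ‖f x‖ₑ ^ p.toReal * weightMeasure m {x} := by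
          rw [weightMeasure_singleton]
          gcongr
          exact hm x
      _ = ∫⁻ y in {x}, ‖f y‖ₑ ^ p.toReal ∂(weightMeasure m) := by
          rw [lintegral_singleton]
      _ ≤ I := setLIntegral_le_lintegral _ _
  have hD : I / ENNReal.ofReal δ ≠ ∞ :=
    ENNReal.div_ne_top hIfin.ne (ENNReal.ofReal_pos.2 hδ).ne'
  have hr : 0 ≤ q.toReal / p.toReal - 1 := sub_nonneg.2 ((one_le_div hp0).2 hpqr)
  calc ∫⁻ x, ‖f x‖ₑ ^ q.toReal ∂(weightMeasure m)
      ≤ ∫⁻ x, (I / ENNReal.ofReal δ) ^ (q.toReal / p.toReal - 1) * ‖f x‖ₑ ^ p.toReal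
          ∂(weightMeasure m) := by
        refine lintegral_mono fun x => ?_
        have e : ‖f x‖ₑ ^ q.toReal =
            (‖f x‖ₑ ^ p.toReal) ^ (q.toReal / p.toReal - 1) * ‖f x‖ₑ ^ p.toReal := by
          rw [← ENNReal.rpow_mul, ← ENNReal.rpow_add_of_nonneg _ _ (mul_nonneg hp0.le hr) hp0.le]
          congr 1
          field_simp
          ring
        rw [e]
        gcongr
        exact hbound x
    _ = (I / ENNReal.ofReal δ) ^ (q.toReal / p.toReal - 1) * I :=
        lintegral_const_mul' _ _ (ENNReal.rpow_ne_top_of_nonneg hr hD)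
    _ < ∞ := ENNReal.mul_lt_top (ENNReal.rpow_lt_top_of_nonneg hr hD) hIfin

theorem exists_subseq_tendsto_eval {p : ℝ≥0∞} [Fact (1 ≤ p)] {u : ℕ → WeightedLp m p}
    {f : WeightedLp m p} (h : Tendsto u atTop (𝓝 f)) :
    ∃ ns : ℕ → ℕ, StrictMono ns ∧
      ∀ x, Tendsto (fun k => eval m p (u (ns k)) x) atTop (𝓝 (eval m p f x)) := by
  let _ : MeasurableSpace X := ⊤
  obtain ⟨ns, hns, hae⟩ := (tendstoInMeasure_of_tendsto_Lp h).exists_seq_tendsto_ae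
  exact ⟨ns, hns, weightMeasure_ae m hae⟩

/-- If the weights are bounded away from zero, then `ℓ^p ⊆ ℓ^q` for `p ≤ q < ∞`, with continuous
inclusion. -/
theorem exists_inclusion {δ : ℝ} (hδ : 0 < δ) (hm : ∀ x, δ ≤ (m x : ℝ)) {p q : ℝ≥0∞}
    [hp : Fact (1 ≤ p)] [Fact (1 ≤ q)] (hpq : p ≤ q) (hq : q ≠ ∞) :
    ∃ i : WeightedLp m p →L[ℂ] WeightedLp m q, ∀ f, eval m q (i f) = eval m p f := by
  let _ : MeasurableSpace X := ⊤
  have hex : ∀ f : WeightedLp m p, ∃ g : WeightedLp m q, eval m q g = eval m p f := by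
    intro f
    have hf := memLp_of_le hδ hm (zero_lt_one.trans_le hp.out).ne' hpq hq (Lp.memLp f)
    exact ⟨hf.toLp _, funext (weightMeasure_ae m hf.coeFn_toLp)⟩
  choose i hi using hex
  let L : WeightedLp m p →ₗ[ℂ] WeightedLp m q :=
    { toFun := i
      map_add' := fun f g => eval_injective q (by rw [hi, map_add, map_add, hi, hi])
      map_smul' := fun c f => eval_injective q (by
        rw [hi, map_smul, map_smul, hi, RingHom.id_apply]) }
  -- The graph is closed because norm convergence in either space gives pointwise convergence along
  -- a subsequence, and pointwise limits agree.
  refine ⟨⟨L, L.continuous_of_seq_closed_graph fun u f g hu hg => eval_injective q ?_⟩, hi⟩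
  obtain ⟨ns, hns, h1⟩ := exists_subseq_tendsto_eval hg
  obtain ⟨ks, hks, h2⟩ := exists_subseq_tendsto_eval (hu.comp hns.tendsto_atTop)
  funext x
  have h3 := (h1 x).comp hks.tendsto_atTop
  refine tendsto_nhds_unique h3 ?_
  change Tendsto _ _ (𝓝 (eval m q (i f) x))
  rw [hi]
  refine (h2 x).congr fun k => ?_
  exact (congrFun (hi _) x).symm

theorem exists_eval_eq_of_finite_support (p : ℝ≥0∞) {f : X → ℂ} (hf : f.support.Finite) :
    ∃ g : WeightedLp m p, eval m p g = f := by
  classical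
  let _ : MeasurableSpace X := ⊤
  have hmem : MemLp f p (weightMeasure m) := by
    have e : f = ∑ x ∈ hf.toFinset, ({x} : Set X).indicator fun _ => f x := by
      funext y
      rw [Finset.sum_apply]
      simp only [Set.indicator_apply, Set.mem_singleton_iff]
      rw [Finset.sum_ite_eq]
      split_ifs with hy
      · rfl
      · simpa using hy
    rw [e]
    refine memLp_finsetSum' _ fun x _ => ?_
    refine memLp_indicator_const p MeasurableSpace.measurableSet_top _ (Or.inr ?_)
    rw [weightMeasure_singleton]
    exact ENNReal.ofReal_ne_top
  exact ⟨hmem.toLp f, funext (weightMeasure_ae m hmem.coeFn_toLp)⟩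

end WeightedLp

theorem theorem4p2 {X : Type*} (m : X → Set.Ioi (0 : ℝ)) (G : MagneticSchrodingerGraph X)
    (hpos : G.IsPositive) (hcl : (G.form m hpos).IsClosable)
    (hm : ∃ δ : ℝ, 0 < δ ∧ ∀ x, δ ≤ (m x : ℝ))
    (p : ℝ≥0∞) [Fact (1 ≤ p)] (hp : p ≠ ∞)
    (Sₚ : ℝ≥0 → WeightedLp m p →L[ℂ] WeightedLp m p) (hSₚ : IsC0Semigroup Sₚ)
    (hcons : IsConsistentExtension (G.S₂ m hpos hcl) Sₚ) :
    (G.H₂ m hpos hcl).spec ⊆ (-semigroupGenerator Sₚ).spec := by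
  obtain ⟨δ, hδ, hm⟩ := hm
  have hA : (G.H₂ m hpos hcl).IsResolvent (-1) (G.form m hpos).resolvent :=
    (G.form m hpos).isResolvent_operator_closure hcl _
  have hK : IsSelfAdjoint (G.form m hpos).resolvent :=
    (G.form m hpos).isPositive_resolvent.isSelfAdjoint
  have hspec := (G.form m hpos).spectrum_resolvent
  rcases le_total p 2 with h | h
  · obtain ⟨i, hi⟩ := WeightedLp.exists_inclusion hδ hm h ENNReal.ofNat_ne_top
    refine spec_subset_of_restriction hA hK hspec i ?_ fun t v => WeightedLp.eval_injective 2 ?_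
    -- The image of $\ell^p$ contains the finitely supported functions, which are dense in $\ell^2$.
    · refine (MagneticSchrodingerGraph.dense_finSupp m).mono fun f hf => ?_
      obtain ⟨g, hg⟩ := WeightedLp.exists_eval_eq_of_finite_support (m := m) p hf
      exact ⟨g, WeightedLp.eval_injective 2 ((hi g).trans hg)⟩
    · rw [hi]
      exact (hcons t (i v) v (hi v)).symm
  · obtain ⟨i, hi⟩ := WeightedLp.exists_inclusion hδ hm h hp
    refine spec_subset_of_extension hA hK hspec i (fun f g hfg => ?_)
      fun t v => WeightedLp.eval_injective p ?_
    · refine WeightedLp.eval_injective 2 ?_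
      rw [← hi f, ← hi g, hfg]
    · rw [hi]
      exact (hcons t v (i v) (hi v).symm).symm
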